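/- Let $\mathbb Z^d$ be the lattice graph whose edges join vertices that differ by one in exactly one coordinate. For a finite $\Lambda\subset\mathbb Z^d$, let $\partial\Lambda$ be its external vertex boundary, $\Lambda^+=\Lambda\cup\partial\Lambda$, and $E(\Lambda^+)$ the set of lattice edges with both endpoints in $\Lambda^+$. For $\eta:\Lambda\to\mathbb R$ and $\lambda>0$, the Hamiltonian of the integer-valued random-field Gaussian free field is $$H^{\eta}_\Lambda(\phi)=\frac12\sum_{\{x,y\}\in E(\Lambda^+)}(\phi(x)-\phi(y))^2-\lambda\sum_{x\in\Lambda}\eta(x)\phi(x),\qquad \phi:\Lambda^+\to\mathbb Z .$$ At inverse temperature $\beta>0$ with zero boundary conditions, the Gibbs measure $\mu^{\beta,\eta}_\Lambda$ assigns probability proportional to $\exp(-\beta H^\eta_\Lambda(\phi))$ to each $\phi:\Lambda^+\to\mathbb Z$ with $\phi\equiv0$ on $\partial\Lambda$. Let $\langle\cdot\rangle_{\mu^{\beta,\eta}_\Lambda}$ denote the expectation under it, and let $\Lambda_L=\{-L,\dots,L\}^d$. **Theorem (height fluctuations, integer-valued, $d\ge3$, low temperature and weak disorder).** Let $d\ge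 3$. There exist constants $\beta_0,\lambda_0,C,c>0$, depending only on $d$, such that for every integer $L\ge2$, every family $(\eta(x))_{x\in\Lambda_L}$ of independent standard Gaussian $N(0,1)$ random variables (with $\mathbb P$ the underlying probability), every $\beta>\beta_0$, every $0<\lambda<\lambda_0$ and every $v\in\Lambda_L$, $$\mathbb P\left(\left\langle \mathbf 1_{\{\phi(v)\neq0\}}\right\rangle_{\mu^{\beta,\eta}_{\Lambda_L}}\le Ce^{-\beta/8}\right)\ge 1-e^{-c/\lambda^2}.$$ -/

import Mathlib

open MeasureTheory ProbabilityTheory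

namespace IVGFF

/-- The standard `d`-dimensional lattice as a graph on `ℤ^d`: two vertices are adjacent if they are
equal in all but one coordinate and differ by one in that coordinate. -/
def lattice (d : ℕ) : SimpleGraph (Fin d → ℤ) where
  Adj x y := ∃ i, |x i - y i| = 1 ∧ ∀ j, j ≠ i → x j = y j
  symm := ⟨by
    rintro x y ⟨i, hi, h⟩
    exact ⟨i, by rw [abs_sub_comm]; exact hi, fun j hj => (h j hj).symm⟩⟩
  loopless := ⟨by
    rintro x ⟨i, hi, -⟩
    simp at hi⟩

/-- The external vertex boundary `∂Λ` of `Λ ⊂ ℤ^d`. -/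
def boundary {d : ℕ} (Λ : Finset (Fin d → ℤ)) : Set (Fin d → ℤ) :=
  {x | x ∉ Λ ∧ ∃ y ∈ Λ, (lattice d).Adj y x}

/-- `Λ⁺ = Λ ∪ ∂Λ`. -/
def plus {d : ℕ} (Λ : Finset (Fin d → ℤ)) : Set (Fin d → ℤ) := ↑Λ ∪ boundary Λ

/-- A vertex of `Λ`, seen as a vertex of `Λ⁺`. -/
def toPlus {d : ℕ} {Λ : Finset (Fin d → ℤ)} (x : Λ) : plus Λ := ⟨x.1, Or.inl x.2⟩

/-- `Λ⁺` is finite (since `Λ` is). -/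
instance finite_plus {d : ℕ} (Λ : Finset (Fin d → ℤ)) : Finite (plus Λ) := by
  have h : plus Λ ⊆ ⋃ y ∈ Λ, Set.Icc (y - 1) (y + 1) := by
    rintro x (hx | ⟨-, y, hy, i, hi, hj⟩)
    · refine Set.mem_biUnion hx ⟨?_, ?_⟩ <;> intro i <;> simp
    · refine Set.mem_biUnion hy ⟨?_, ?_⟩ <;> intro k <;>
        by_cases hk : k = i
      · subst hk
        have := (abs_le.mp hi.le).2
        simp only [Pi.sub_apply, Pi.one_apply]; omega
      · have := hj k hk
        simp only [Pi.sub_apply, Pi.one_apply]; omega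
      · subst hk
        have := (abs_le.mp hi.le).1
        simp only [Pi.add_apply, Pi.one_apply]; omega
      · have := hj k hk
        simp only [Pi.add_apply, Pi.one_apply]; omega
  exact ((Λ.finite_toSet.biUnion fun y _ => Set.finite_Icc _ _).subset h).to_subtype

/-- `E(Λ⁺)`: the (undirected) lattice edges with both endpoints in `Λ⁺`. -/
noncomputable def edges {d : ℕ} (Λ : Finset (Fin d → ℤ)) : Finset (Sym2 (plus Λ)) :=
  (Set.toFinite ((lattice d).induce (plus Λ)).edgeSet).toFinset

/-- The squared gradient `(∇φ(e))²` of `φ : V → ℤ` along an undirected edge `e`. -/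
def gradSq {V : Type*} (φ : V → ℤ) : Sym2 V → ℝ :=
  Sym2.lift ⟨fun x y => ((φ y : ℝ) - (φ x : ℝ)) ^ 2, fun x y => by ring⟩

/-- The Hamiltonian
`H(φ) = (1/2) ∑_{e ∈ E(Λ⁺)} (∇φ(e))² - λ ∑_{x ∈ Λ} η(x) φ(x)` for `φ : Λ⁺ → ℤ`. -/
noncomputable def hamiltonian {d : ℕ} (Λ : Finset (Fin d → ℤ)) (lam : ℝ) (η : Λ → ℝ)
    (φ : plus Λ → ℤ) : ℝ :=
  1 / 2 * ∑ e ∈ edges Λ, gradSq φ e - lam * ∑ x : Λ, η x * (φ (toPlus x) : ℝ)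

/-- The surfaces `φ : Λ⁺ → ℤ` with `φ ≡ 0` on `∂Λ`. -/
abbrev Surface {d : ℕ} (Λ : Finset (Fin d → ℤ)) : Type :=
  {φ : plus Λ → ℤ // ∀ x : plus Λ, (x : Fin d → ℤ) ∈ boundary Λ → φ x = 0}

/-- The Boltzmann weight `exp (-β H(φ))`. -/
noncomputable def weight {d : ℕ} (Λ : Finset (Fin d → ℤ)) (β lam : ℝ) (η : Λ → ℝ)
    (φ : Surface Λ) : ℝ :=
  Real.exp (-β * hamiltonian Λ lam η φ.1)

/-- The partition function, the sum of the weights in `[0, ∞]`; it is shown to be positive and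
finite below. -/
noncomputable def partitionFunction {d : ℕ} (Λ : Finset (Fin d → ℤ)) (β lam : ℝ) (η : Λ → ℝ) :
    ENNReal :=
  ∑' φ : Surface Λ, ENNReal.ofReal (weight Λ β lam η φ)

/-- The integer-valued random-field Gaussian free field on `Λ` at inverse temperature `β`, with
zero boundary conditions and external field `η` of strength `lam`. -/
noncomputable def gibbs {d : ℕ} (Λ : Finset (Fin d → ℤ)) (β lam : ℝ) (η : Λ → ℝ) :
    Measure (Surface Λ) :=
  (partitionFunction Λ β lam η)⁻¹ •
    Measure.sum fun φ : Surface Λ =>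
      ENNReal.ofReal (weight Λ β lam η φ) • Measure.dirac φ

/-- The thermal expectation `⟨f⟩` of an observable `f`. -/
noncomputable def thermal {d : ℕ} (Λ : Finset (Fin d → ℤ)) (β lam : ℝ) (η : Λ → ℝ)
    (f : Surface Λ → ℝ) : ℝ :=
  ∫ φ, f φ ∂(gibbs Λ β lam η)

/-- The box `Λ_L = {-L, …, L}^d`. -/
noncomputable def box (d L : ℕ) : Finset (Fin d → ℤ) :=
  Fintype.piFinset fun _ => Finset.Icc (-(L : ℤ)) (L : ℤ)

/-! The following facts show that `gibbs` is indeed a probability measure, which gives each surface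
the probability `exp (-β H(φ)) / Z`. -/

lemma gradSq_nonneg {V : Type*} (φ : V → ℤ) (e : Sym2 V) : 0 ≤ gradSq φ e := by
  induction e with
  | _ x y => exact sq_nonneg ((φ y : ℝ) - (φ x : ℝ))

lemma abs_le_of_grad {d : ℕ} (hd : 0 < d) (Λ : Finset (Fin d → ℤ)) :
    ∃ N : ℕ, ∀ (φ : Surface Λ) (x : plus Λ),
      |(φ.1 x : ℝ)| ≤ N * Real.sqrt (∑ e ∈ edges Λ, gradSq φ.1 e) := by
  obtain ⟨B, hB⟩ : ∃ B : ℤ, ∀ x ∈ plus Λ, |x ⟨0, hd⟩| < B := by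
    obtain ⟨M, hM⟩ := ((Set.toFinite (plus Λ)).image fun x => |x ⟨0, hd⟩|).bddAbove
    exact ⟨M + 1, fun x hx => by have := hM ⟨x, hx, rfl⟩; simp only at this; omega⟩
  refine ⟨(2 * B).toNat, fun φ x => ?_⟩
  set m := Real.sqrt (∑ e ∈ edges Λ, gradSq φ.1 e) with hm
  have hm0 : 0 ≤ m := Real.sqrt_nonneg _
  have key : ∀ n : ℕ, ∀ y : plus Λ, B - y.1 ⟨0, hd⟩ ≤ n → |(φ.1 y : ℝ)| ≤ n * m := by
    intro n
    induction n with
    | zero =>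
      intro y hy
      have := (abs_lt.mp (hB y.1 y.2)).2
      push_cast at hy; omega
    | succ n ih =>
      intro y hy
      rcases y.2 with hyΛ | hyb
      · let z : Fin d → ℤ := Function.update y.1 ⟨0, hd⟩ (y.1 ⟨0, hd⟩ + 1)
        have hadj : (lattice d).Adj y.1 z :=
          ⟨⟨0, hd⟩, by simp [z], fun j hj => by simp [z, Function.update_of_ne hj]⟩
        have hz : z ∈ plus Λ := by
          by_cases h : z ∈ Λ
          · exact Or.inl h
          · exact Or.inr ⟨h, y.1, hyΛ, hadj⟩
        have h1 := ih ⟨z, hz⟩ (by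
          simp only [z, Function.update_self]; push_cast at hy; omega)
        have he : s(y, (⟨z, hz⟩ : plus Λ)) ∈ edges Λ := by
          simp only [edges, Set.Finite.mem_toFinset, SimpleGraph.mem_edgeSet]
          exact hadj
        have h2 : |(φ.1 ⟨z, hz⟩ : ℝ) - φ.1 y| ≤ m :=
          Real.abs_le_sqrt (Finset.single_le_sum (f := gradSq φ.1)
            (fun e _ => gradSq_nonneg φ.1 e) he)
        have h3 := abs_sub_abs_le_abs_sub (φ.1 y : ℝ) (φ.1 ⟨z, hz⟩)
        rw [abs_sub_comm] at h3
        push_cast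
        linarith
      · rw [φ.2 y hyb]; simp; positivity
  refine key _ x ?_
  have := (abs_lt.mp (hB x.1 x.2)).1
  have := Int.self_le_toNat (2 * B)
  omega

lemma summable_one_site {a : ℝ} (ha : 0 < a) (b : ℝ) :
    Summable fun n : ℤ => Real.exp (-a * (n : ℝ) ^ 2 + b * |(n : ℝ)|) := by
  have h := summable_pow_mul_jacobiTheta₂_term_bound (b / (2 * Real.pi))
    (T := a / Real.pi) (by positivity) 0
  refine h.congr fun n => ?_
  simp only [pow_zero, one_mul]
  congr 1
  have := Real.pi_ne_zero
  push_cast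
  field_simp
  ring

lemma summable_prod_sites {ι : Type*} [Fintype ι] {f : ι → ℤ → ℝ}
    (h0 : ∀ i n, 0 ≤ f i n) (hf : ∀ i, Summable (f i)) :
    Summable fun φ : ι → ℤ => ∏ i, f i (φ i) := by
  classical
  refine summable_of_sum_le (c := ∏ i, ∑' n, f i n)
    (fun φ => Finset.prod_nonneg fun i _ => h0 i _) fun S => ?_
  calc ∑ φ ∈ S, ∏ i, f i (φ i)
      ≤ ∑ φ ∈ Fintype.piFinset fun i => S.image fun φ => φ i, ∏ i, f i (φ i) := by
        refine Finset.sum_le_sum_of_subset_of_nonneg (fun φ hφ => ?_)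
          fun φ _ _ => Finset.prod_nonneg fun i _ => h0 i _
        exact Fintype.mem_piFinset.mpr fun i => Finset.mem_image_of_mem _ hφ
    _ = ∏ i, ∑ n ∈ S.image fun φ => φ i, f i n := (Finset.prod_univ_sum _ _).symm
    _ ≤ ∏ i, ∑' n, f i n :=
        Finset.prod_le_prod (fun i _ => Finset.sum_nonneg fun n _ => h0 i n)
          fun i _ => (hf i).sum_le_tsum _ fun n _ => h0 i n

lemma summable_weight {d : ℕ} (hd : 0 < d) (Λ : Finset (Fin d → ℤ)) {β : ℝ} (hβ : 0 < β)
    (lam : ℝ) (η : Λ → ℝ) : Summable (weight Λ β lam η) := by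
  obtain ⟨N, hN⟩ := abs_le_of_grad hd Λ
  set K : ℝ := (Fintype.card Λ : ℝ) * (N : ℝ) ^ 2 + 1 with hK
  have hKpos : 0 < K := by positivity
  have hs := summable_prod_sites (ι := Λ)
    (f := fun x n => Real.exp (-(β / (2 * K)) * (n : ℝ) ^ 2 + β * |lam * η x| * |(n : ℝ)|))
    (fun _ _ => (Real.exp_pos _).le) fun x => summable_one_site (by positivity) _
  have hinj : Function.Injective fun (φ : Surface Λ) (x : Λ) => φ.1 (toPlus x) := by
    intro φ ψ h
    refine Subtype.ext (funext fun x => ?_)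
    by_cases hx : x.1 ∈ boundary Λ
    · rw [φ.2 x hx, ψ.2 x hx]
    · exact congrFun h ⟨x.1, x.2.resolve_right hx⟩
  refine Summable.of_nonneg_of_le (fun φ => (Real.exp_pos _).le) (fun φ => ?_)
    (hs.comp_injective hinj)
  simp only [Function.comp, weight, hamiltonian]
  rw [← Real.exp_sum]
  refine Real.exp_le_exp.mpr ?_
  set G := ∑ e ∈ edges Λ, gradSq φ.1 e with hG
  have hG0 : 0 ≤ G := Finset.sum_nonneg fun e _ => gradSq_nonneg φ.1 e
  have h1 : ∑ x : Λ, (φ.1 (toPlus x) : ℝ) ^ 2 ≤ K * G := by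
    calc ∑ x : Λ, (φ.1 (toPlus x) : ℝ) ^ 2 ≤ ∑ _x : Λ, (N : ℝ) ^ 2 * G := by
          refine Finset.sum_le_sum fun x _ => ?_
          rw [← sq_abs, ← Real.sq_sqrt hG0, ← mul_pow]
          exact pow_le_pow_left₀ (abs_nonneg _) (hN φ _) 2
      _ ≤ K * G := by
          rw [Finset.sum_const, Finset.card_univ, nsmul_eq_mul, hK]
          nlinarith
  have h2 : lam * ∑ x : Λ, η x * (φ.1 (toPlus x) : ℝ)
      ≤ ∑ x : Λ, |lam * η x| * |(φ.1 (toPlus x) : ℝ)| := by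
    rw [Finset.mul_sum]
    refine Finset.sum_le_sum fun x _ => ?_
    rw [← abs_mul, ← mul_assoc]
    exact le_abs_self _
  have h3 : (β / (2 * K)) * ∑ x : Λ, (φ.1 (toPlus x) : ℝ) ^ 2 ≤ β / 2 * G := by
    calc _ ≤ (β / (2 * K)) * (K * G) := mul_le_mul_of_nonneg_left h1 (by positivity)
      _ = β / 2 * G := by field_simp
  have h4 := mul_le_mul_of_nonneg_left h2 hβ.le
  rw [Finset.sum_add_distrib, ← Finset.mul_sum]
  simp_rw [mul_assoc β]
  rw [← Finset.mul_sum]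
  linarith

lemma partitionFunction_ne_top {d : ℕ} (hd : 0 < d) (Λ : Finset (Fin d → ℤ)) {β : ℝ}
    (hβ : 0 < β) (lam : ℝ) (η : Λ → ℝ) : partitionFunction Λ β lam η ≠ ⊤ :=
  (summable_weight hd Λ hβ lam η).tsum_ofReal_ne_top

lemma partitionFunction_ne_zero {d : ℕ} (Λ : Finset (Fin d → ℤ)) (β lam : ℝ) (η : Λ → ℝ) :
    partitionFunction Λ β lam η ≠ 0 := by
  intro h
  have := ENNReal.tsum_eq_zero.mp h ⟨0, fun _ _ => rfl⟩
  exact absurd (ENNReal.ofReal_eq_zero.mp this) (not_le.mpr (Real.exp_pos _))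

/-- `gibbs` is a probability measure. -/
theorem isProbabilityMeasure_gibbs {d : ℕ} (hd : 0 < d) (Λ : Finset (Fin d → ℤ)) {β : ℝ}
    (hβ : 0 < β) (lam : ℝ) (η : Λ → ℝ) : IsProbabilityMeasure (gibbs Λ β lam η) := by
  refine ⟨?_⟩
  have h : (Measure.sum fun φ : Surface Λ =>
      ENNReal.ofReal (weight Λ β lam η φ) • Measure.dirac φ) Set.univ
      = partitionFunction Λ β lam η := by
    simp [Measure.sum_apply, partitionFunction]
  rw [gibbs, Measure.smul_apply, h, smul_eq_mul]
  exact ENNReal.inv_mul_cancel (partitionFunction_ne_zero Λ β lam η)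
    (partitionFunction_ne_top hd Λ hβ lam η)

/-- `gibbs` gives each surface `φ` the probability `exp (-β H(φ)) / Z`. -/
theorem gibbs_singleton {d : ℕ} (Λ : Finset (Fin d → ℤ)) (β lam : ℝ) (η : Λ → ℝ)
    (φ : Surface Λ) :
    gibbs Λ β lam η {φ}
      = ENNReal.ofReal (weight Λ β lam η φ) / partitionFunction Λ β lam η := by
  classical
  have h : (Measure.sum fun ψ : Surface Λ =>
      ENNReal.ofReal (weight Λ β lam η ψ) • Measure.dirac ψ) {φ}
      = ENNReal.ofReal (weight Λ β lam η φ) := by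
    rw [Measure.sum_apply _ (measurableSet_singleton φ), tsum_eq_single φ]
    · simp
    · intro ψ hψ
      simp [Measure.dirac_apply' _ (measurableSet_singleton φ), hψ]
  rw [gibbs, Measure.smul_apply, h, smul_eq_mul, mul_comm, ENNReal.div_eq_inv_mul, mul_comm]

end IVGFF

namespace IVGFF

/-! ### Exponential moments of excesses of Gaussian block sums -/

section Probability

open scoped ENNReal

variable {Ω ι κ : Type*} [MeasurableSpace Ω] {P : Measure Ω} [IsProbabilityMeasure P]
  {Y : ι → Ω → ℝ}

/-! This is a Peierls argument in a random field. Suppose `φ v ≥ 1`, the other sign being symmetric,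
and let `u` be the indicator of `φ ≥ 1`. The edges where `u` jumps split into classes linked through
plaquettes. The gradient of `u` restricted to one class is closed on plaquettes, hence the gradient
of a finitely supported `f`, and some class has `f v ≠ 0` (`exists_contour`). On each of the `N`
edges of this contour `φ` moves in the same direction as `f`, so passing from `φ` to `φ - f` lowers
the gradient energy by at least `N / 2` (`card_le_sum_gradSq_sub`). If the disorder term changes by
at most `N / 4`, the weight grows by a factor `exp (β N / 4)`. As `φ ↦ φ - f` is injective for fixed
`f`, and there are at most `(9 ^ d) ^ (4 N + 1)` contours of size `N`, summing over contours bounds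
the probability of `φ v ≠ 0` by a multiple of `exp (-β / 4)` (`gibbs_ne_zero_le`).

It remains to have `λ |∑ η f| ≤ N / 4` for all contours at once. A plain union bound fails: the
variance of `∑ η f` can be of order `N ^ (d / (d - 1))`, so the Gaussian tail at height `N / λ`
loses against the exponential number of contours. Instead the pairing of `η` and `f` is telescoped
over averages on nested dyadic blocks with `2 ^ n` sites and sides about `2 ^ (n / d)`. A block sum
of `η` is typically of order `2 ^ (n / 2)`, and a Poincaré inequality bounds the change of the block
average of `f` by `2 ^ (n / d) / 2 ^ n` times the number of contour edges nearby. Scale `n` thus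
contributes about `(n + 1) 2 ^ (n (1/d - 1/2)) T N`, which is summable because `d ≥ 3`
(`abs_sum_mul_le_of_isRegular`).

Blocks with atypically large sums are controlled collectively. A contour of size `N` lies along a
walk of length at most `4 N` from `v`, which passes near only about `N / 2 ^ n + 1` cubes of side `2
^ (n + 1)`. A union bound is therefore needed only over coarse walks of cubes, whose number is
exponential in their length alone (`measure_not_isRegular_le`). It fails with probability at most `4
exp (-T ^ 2 / 2)`, where `T` is of order `1 / λ`. -/

lemma lintegral_exp_sum (hi : iIndepFun Y P) (hm : ∀ i, Measurable (Y i))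
    (hl : ∀ i, P.map (Y i) = gaussianReal 0 1) (S : Finset ι) (s : ℝ) :
    ∫⁻ ω, ENNReal.ofReal (Real.exp (s * ∑ i ∈ S, Y i ω)) ∂P
      = ENNReal.ofReal (Real.exp (S.card * s ^ 2 / 2)) := by
  have hint : Integrable (fun ω => Real.exp (s * ∑ i ∈ S, Y i ω)) P := by
    have := hi.integrable_exp_mul_sum hm (s := S) (t := s) fun i _ => by
      have h := integrable_exp_mul_gaussianReal (μ := 0) (v := 1) s
      rw [← hl i] at h
      exact h.comp_measurable (hm i)
    simpa using this
  rw [← ofReal_integral_eq_lintegral_ofReal hint (ae_of_all _ fun _ => (Real.exp_pos _).le)]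
  have h := hi.mgf_sum hm (t := s) S
  rw [Finset.prod_congr rfl fun i _ => mgf_gaussianReal (hl i) s] at h
  simp only [mgf, Finset.sum_apply] at h
  rw [h, Finset.prod_const, ← Real.exp_nat_mul]
  congr 2
  push_cast
  ring

/-- The tilt `u / V` minimises `V s ^ 2 / 2 - s u`. With it a block costs only a factor `1 + small`,
because the excess vanishes unless the block sum is exceptional. -/
lemma lintegral_exp_excess_le (hi : iIndepFun Y P) (hm : ∀ i, Measurable (Y i))
    (hl : ∀ i, P.map (Y i) = gaussianReal 0 1) (S : Finset ι) {V u : ℝ} (hV : 0 < V)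
    (hS : (S.card : ℝ) ≤ V) (hu : 0 ≤ u) :
    ∫⁻ ω, ENNReal.ofReal (Real.exp (u / V * max (|∑ i ∈ S, Y i ω| - u) 0)) ∂P
      ≤ ENNReal.ofReal (1 + 2 * Real.exp (-u ^ 2 / (2 * V))) := by
  set s := u / V with hs
  have hs0 : 0 ≤ s := by positivity
  -- If the excess is positive, the left side equals one of the two tilted exponentials; otherwise
  -- it is `1`.
  have hpt : ∀ x : ℝ, Real.exp (s * max (|x| - u) 0)
      ≤ 1 + (Real.exp (-(s * u)) * Real.exp (s * x) + Real.exp (-(s * u)) * Real.exp (-s * x)) := by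
    intro x
    rw [← Real.exp_add, ← Real.exp_add]
    have h1 := Real.exp_pos (-(s * u) + s * x)
    have h2 := Real.exp_pos (-(s * u) + -s * x)
    rcases max_cases (|x| - u) 0 with ⟨h, -⟩ | ⟨h, -⟩
    · rw [h]
      rcases abs_cases x with ⟨hx, -⟩ | ⟨hx, -⟩
      · rw [hx, show s * (x - u) = -(s * u) + s * x by ring]; linarith
      · rw [hx, show s * (-x - u) = -(s * u) + -s * x by ring]; linarith
    · rw [h, mul_zero, Real.exp_zero]; linarith
  have hmX : Measurable fun ω => ∑ i ∈ S, Y i ω := Finset.measurable_sum _ fun i _ => hm i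
  calc ∫⁻ ω, ENNReal.ofReal (Real.exp (s * max (|∑ i ∈ S, Y i ω| - u) 0)) ∂P
      ≤ ∫⁻ ω, (1 + (ENNReal.ofReal (Real.exp (-(s * u)))
            * ENNReal.ofReal (Real.exp (s * ∑ i ∈ S, Y i ω))
          + ENNReal.ofReal (Real.exp (-(s * u)))
            * ENNReal.ofReal (Real.exp (-s * ∑ i ∈ S, Y i ω)))) ∂P := by
        refine lintegral_mono fun ω => ?_
        rw [← ENNReal.ofReal_mul (Real.exp_pos _).le, ← ENNReal.ofReal_mul (Real.exp_pos _).le,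
          ← ENNReal.ofReal_add (by positivity) (by positivity), ← ENNReal.ofReal_one,
          ← ENNReal.ofReal_add (by positivity) (by positivity)]
        exact ENNReal.ofReal_le_ofReal (hpt _)
    _ = ENNReal.ofReal (1 + 2 * (Real.exp (-(s * u)) * Real.exp (S.card * s ^ 2 / 2))) := by
        rw [lintegral_add_left measurable_const, lintegral_add_left (by fun_prop),
          lintegral_const_mul _ (by fun_prop), lintegral_const_mul _ (by fun_prop),
          lintegral_exp_sum hi hm hl, lintegral_exp_sum hi hm hl, lintegral_one, measure_univ,
          neg_sq, ← two_mul, ← ENNReal.ofReal_mul (Real.exp_pos _).le,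
          ENNReal.ofReal_add zero_le_one (by positivity), ENNReal.ofReal_one,
          ENNReal.ofReal_mul zero_le_two]
        simp
    _ ≤ _ := by
        refine ENNReal.ofReal_le_ofReal ?_
        rw [← Real.exp_add]
        gcongr
        have : (S.card : ℝ) * s ^ 2 / 2 ≤ V * s ^ 2 / 2 := by gcongr
        have h2 : V * s ^ 2 / 2 - s * u = -u ^ 2 / (2 * V) := by
          rw [hs]; field_simp; ring
        linarith

/-- Sums over disjoint sets of independent variables are independent, so the integral factorises;
one block is split off at a time. -/
lemma lintegral_prod_blocks_le (hi : iIndepFun Y P) (hm : ∀ i, Measurable (Y i)) (R : Finset κ)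
    (S : κ → Finset ι) (hd : (R : Set κ).PairwiseDisjoint S) (g : ℝ → ℝ≥0∞) (hg : Measurable g)
    {M : ℝ≥0∞} (hM : ∀ b ∈ R, ∫⁻ ω, g (∑ i ∈ S b, Y i ω) ∂P ≤ M) :
    ∫⁻ ω, ∏ b ∈ R, g (∑ i ∈ S b, Y i ω) ∂P ≤ M ^ R.card := by
  classical
  induction R using Finset.induction_on with
  | empty => simp
  | insert a R ha ih =>
    have hdis : Disjoint (S a) (R.biUnion S) := by
      rw [Finset.disjoint_biUnion_right]
      intro b hb
      exact hd (by simp) (by simp [hb]) (fun h => ha (h ▸ hb))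
    have hind := hi.indepFun_finset (S a) (R.biUnion S) hdis hm
    let p : (S a → ℝ) → ℝ≥0∞ := fun z => g (∑ i, z i)
    let q : (R.biUnion S → ℝ) → ℝ≥0∞ := fun z =>
      ∏ b ∈ R.attach, g (∑ i ∈ (S b.1).attach,
        z ⟨i.1, Finset.mem_biUnion.mpr ⟨b.1, b.2, i.2⟩⟩)
    have hp : Measurable p := by fun_prop
    have hq : Measurable q := by fun_prop
    have hpe : ∀ ω, p (fun i => Y i ω) = g (∑ i ∈ S a, Y i ω) := fun ω => by
      simp only [p]; rw [Finset.sum_coe_sort (S a) fun i => Y i ω]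
    have hqe : ∀ ω, q (fun i => Y i ω) = ∏ b ∈ R, g (∑ i ∈ S b, Y i ω) := fun ω => by
      simp only [q]
      rw [← Finset.prod_attach R]
      refine Finset.prod_congr rfl fun b _ => ?_
      rw [Finset.sum_attach (S b.1) fun i => Y i ω]
    have hmul := lintegral_mul_eq_lintegral_mul_lintegral_of_indepFun''
      (f := fun ω => p fun i => Y i ω) (g := fun ω => q fun i => Y i ω) (μ := P)
      (by fun_prop) (by fun_prop) (hind.comp hp hq)
    simp only [hpe, hqe] at hmul
    simp_rw [Finset.prod_insert ha]
    rw [hmul, Finset.card_insert_of_notMem ha, pow_succ']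
    exact mul_le_mul' (hM a (by simp)) (ih (hd.subset (by simp)) fun b hb => hM b (by simp [hb]))

/-- Exponential Markov inequality for the total excess, with the tilt `u / V`. -/
lemma measure_excess_le (hi : iIndepFun Y P) (hm : ∀ i, Measurable (Y i))
    (hl : ∀ i, P.map (Y i) = gaussianReal 0 1) (R : Finset κ)
    (S : κ → Finset ι) (hd : (R : Set κ).PairwiseDisjoint S) {V u : ℝ} (hV : 0 < V)
    (hS : ∀ b ∈ R, ((S b).card : ℝ) ≤ V) (hu : 0 ≤ u) (a : ℝ) :
    P {ω | a ≤ ∑ b ∈ R, max (|∑ i ∈ S b, Y i ω| - u) 0}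
      ≤ ENNReal.ofReal (Real.exp (-(u / V * a)) *
        (1 + 2 * Real.exp (-u ^ 2 / (2 * V))) ^ R.card) := by
  have h1 := lintegral_prod_blocks_le hi hm R S hd
    (fun x => ENNReal.ofReal (Real.exp (u / V * max (|x| - u) 0))) (by fun_prop)
    (fun b hb => lintegral_exp_excess_le hi hm hl (S b) hV (hS b hb) hu)
  have h2 := mul_meas_ge_le_lintegral₀ (μ := P)
    (f := fun ω => ∏ b ∈ R, ENNReal.ofReal (Real.exp (u / V * max (|∑ i ∈ S b, Y i ω| - u) 0)))
    (by fun_prop) (ENNReal.ofReal (Real.exp (u / V * a)))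
  have h3 : {ω | a ≤ ∑ b ∈ R, max (|∑ i ∈ S b, Y i ω| - u) 0} ⊆
      {ω | ENNReal.ofReal (Real.exp (u / V * a)) ≤
        ∏ b ∈ R, ENNReal.ofReal (Real.exp (u / V * max (|∑ i ∈ S b, Y i ω| - u) 0))} := by
    intro ω hω
    simp only [Set.mem_ofPred_eq] at hω ⊢
    rw [← ENNReal.ofReal_prod_of_nonneg fun _ _ => (Real.exp_pos _).le, ← Real.exp_sum,
      ← Finset.mul_sum]
    exact ENNReal.ofReal_le_ofReal (Real.exp_le_exp.mpr (by gcongr))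
  have h4 := (mul_le_mul_right (measure_mono (μ := P) h3) _).trans (h2.trans h1)
  rw [ENNReal.ofReal_mul (Real.exp_pos _).le, ENNReal.ofReal_pow (by positivity), Real.exp_neg,
    ENNReal.ofReal_inv_of_pos (Real.exp_pos _), mul_comm, ← div_eq_mul_inv]
  rw [ENNReal.le_div_iff_mul_le (by simp [Real.exp_pos]) (by simp), mul_comm]
  exact h4

end Probability

end IVGFF

namespace IVGFF

/-! ### Nested dyadic blocks and a Poincaré inequality -/

section Blocks

variable {d : ℕ}

/-- The forward difference of `f` at `x` in direction `i`. -/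
def grad (f : (Fin d → ℤ) → ℤ) (i : Fin d) (x : Fin d → ℤ) : ℤ := f (x + Pi.single i 1) - f x

/-- The dyadic exponent of the `n`-th block partition in direction `i`: the partition `n + 1` is
obtained by merging pairs of blocks of the partition `n` in direction `n % d`. -/
def scale (d n : ℕ) (i : Fin d) : ℕ := (n + (d - 1 - i)) / d

/-- The index of the block of the `n`-th partition that contains `x`. -/
def blockIdx (n : ℕ) (x : Fin d → ℤ) : Fin d → ℤ := fun i => x i / 2 ^ scale d n i

/-- The index of the dyadic cube of side `2 ^ n` that contains `x`. -/
def cubeIdx (n : ℕ) (x : Fin d → ℤ) : Fin d → ℤ := fun i => x i / 2 ^ n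

/-- The block of the `n`-th partition with index `b`. -/
noncomputable def block (n : ℕ) (b : Fin d → ℤ) : Finset (Fin d → ℤ) :=
  Fintype.piFinset fun i => Finset.Ico (b i * 2 ^ scale d n i) ((b i + 1) * 2 ^ scale d n i)

/-- The direction in which the blocks of the `n`-th partition are merged. -/
def mergeDir (hd : 0 < d) (n : ℕ) : Fin d := ⟨n % d, Nat.mod_lt n hd⟩

lemma scale_zero (i : Fin d) : scale d 0 i = 0 := by
  have := i.2
  exact Nat.div_eq_of_lt (by omega)

/-- The floor counts the `k < n` with `k % d = i`, that is, the mergers in direction `i` so far; it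
jumps exactly when `d` divides `n + d - i`. -/
lemma scale_succ (hd : 0 < d) (n : ℕ) (i : Fin d) :
    scale d (n + 1) i = scale d n i + if i = mergeDir hd n then 1 else 0 := by
  have hi := i.2
  unfold scale
  rw [show n + 1 + (d - 1 - i) = n + (d - 1 - (i : ℕ)) + 1 by omega, Nat.succ_div]
  congr 1
  have hmod := Nat.div_add_mod n d
  have hlt := Nat.mod_lt n hd
  refine if_congr ?_ rfl rfl
  rw [Fin.ext_iff, mergeDir]
  simp only
  have h1 : n + (d - 1 - (i : ℕ)) + 1 = d * (n / d) + (n % d + d - i) := by omega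
  rw [h1, ← Nat.dvd_add_iff_right (Dvd.intro _ rfl)]
  constructor
  · rintro ⟨k, hk⟩
    have : k = 1 := by
      rcases k with _ | _ | k
      · omega
      · rfl
      · have : d * (k + 1 + 1) = d * k + d + d := by ring
        have := Nat.zero_le (d * k)
        omega
    subst this
    omega
  · intro h
    exact ⟨1, by omega⟩

lemma scale_mergeDir (hd : 0 < d) (n : ℕ) : scale d n (mergeDir hd n) = n / d := by
  unfold scale mergeDir
  have hmod := Nat.div_add_mod n d
  have hlt := Nat.mod_lt n hd
  simp only
  rw [show n + (d - 1 - n % d) = (d - 1) + d * (n / d) by omega, Nat.add_mul_div_left _ _ hd,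
    Nat.div_eq_of_lt (by omega), zero_add]

lemma sum_scale (hd : 0 < d) (n : ℕ) : ∑ i, scale d n i = n := by
  induction n with
  | zero => simp [scale_zero]
  | succ n ih => simp [scale_succ hd, Finset.sum_add_distrib, ih]

lemma scale_le (hd : 0 < d) (n : ℕ) (i : Fin d) : scale d n i ≤ n := by
  conv_rhs => rw [← sum_scale hd n]
  exact Finset.single_le_sum (f := fun i => scale d n i) (fun _ _ => Nat.zero_le _)
    (Finset.mem_univ i)

lemma ediv_eq_iff_mem_Ico (a b : ℤ) {c : ℤ} (hc : 0 < c) :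
    a / c = b ↔ a ∈ Finset.Ico (b * c) ((b + 1) * c) := by
  rw [Finset.mem_Ico, le_antisymm_iff, Int.le_ediv_iff_mul_le hc, ← Int.lt_add_one_iff,
    Int.ediv_lt_iff_lt_mul hc]
  tauto

lemma mem_block {n : ℕ} {b x : Fin d → ℤ} : x ∈ block n b ↔ blockIdx n x = b := by
  rw [block, Fintype.mem_piFinset, funext_iff]
  exact forall_congr' fun i => (ediv_eq_iff_mem_Ico _ _ (by positivity)).symm

lemma card_block (hd : 0 < d) (n : ℕ) (b : Fin d → ℤ) : (block n b).card = 2 ^ n := by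
  rw [block, Fintype.card_piFinset]
  conv_rhs => rw [← sum_scale hd n, ← Finset.prod_pow_eq_pow_sum]
  refine Finset.prod_congr rfl fun i _ => ?_
  rw [Int.card_Ico, add_mul, one_mul, add_sub_cancel_left]
  norm_cast

lemma blockIdx_zero (x : Fin d → ℤ) : blockIdx 0 x = x := by
  funext i
  simp [blockIdx, scale_zero]

/-- The index of the block of the partition `n + 1` that contains the block `b` of the
partition `n`. -/
def parent (hd : 0 < d) (n : ℕ) (b : Fin d → ℤ) : Fin d → ℤ :=
  Function.update b (mergeDir hd n) (b (mergeDir hd n) / 2)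

/-- The block that is merged with `b`. -/
def sibling (hd : 0 < d) (n : ℕ) (b : Fin d → ℤ) : Fin d → ℤ :=
  if b (mergeDir hd n) % 2 = 0 then b + Pi.single (mergeDir hd n) 1
  else b - Pi.single (mergeDir hd n) 1

lemma blockIdx_succ (hd : 0 < d) (n : ℕ) (x : Fin d → ℤ) :
    blockIdx (n + 1) x = parent hd n (blockIdx n x) := by
  funext i
  by_cases hi : i = mergeDir hd n
  · subst hi
    simp only [blockIdx, parent, Function.update_self, scale_succ hd, if_true, pow_succ]
    rw [Int.ediv_ediv_of_nonneg (by positivity)]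
  · simp [blockIdx, parent, scale_succ hd, hi]

lemma parent_eq_parent_iff (hd : 0 < d) (n : ℕ) (a b : Fin d → ℤ) :
    parent hd n a = parent hd n b ↔ a = b ∨ a = sibling hd n b := by
  set i := mergeDir hd n with hi
  have key : parent hd n a = parent hd n b ↔ a i / 2 = b i / 2 ∧ ∀ j, j ≠ i → a j = b j := by
    constructor
    · intro h
      refine ⟨by simpa [parent, ← hi] using congrFun h i, fun j hj => ?_⟩
      simpa [parent, Function.update_of_ne hj, ← hi] using congrFun h j
    · rintro ⟨h1, h2⟩
      funext j
      by_cases hj : j = i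
      · rw [hj]; simpa [parent, ← hi] using h1
      · simpa [parent, Function.update_of_ne hj, ← hi] using h2 j hj
  rw [key]
  constructor
  · rintro ⟨h1, h2⟩
    by_cases hab : a i = b i
    · left
      funext j
      by_cases hj : j = i
      · rw [hj, hab]
      · exact h2 j hj
    · right
      funext j
      unfold sibling
      by_cases hj : j = i
      · rw [hj, ← hi]
        split_ifs <;> simp <;> omega
      · rw [h2 j hj, ← hi]
        split_ifs <;> simp [hj]
  · rintro (rfl | h)
    · simp
    · refine ⟨?_, fun j hj => ?_⟩
      · rw [h, sibling, ← hi]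
        split_ifs <;> simp <;> omega
      · rw [h, sibling, ← hi]
        split_ifs <;> simp [hj]

lemma sibling_ne (hd : 0 < d) (n : ℕ) (b : Fin d → ℤ) : b ≠ sibling hd n b := by
  intro h
  have := congrFun h (mergeDir hd n)
  unfold sibling at this
  split_ifs at this <;> simp at this
  omega

lemma sum_block_succ (hd : 0 < d) (n : ℕ) (b : Fin d → ℤ) (f : (Fin d → ℤ) → ℤ) :
    ∑ x ∈ block (n + 1) (parent hd n b), f x
      = ∑ x ∈ block n b, f x + ∑ x ∈ block n (sibling hd n b), f x := by
  rw [← Finset.sum_union]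
  · refine Finset.sum_congr ?_ fun _ _ => rfl
    ext x
    rw [Finset.mem_union, mem_block, mem_block, mem_block, blockIdx_succ hd, parent_eq_parent_iff]
  · rw [Finset.disjoint_left]
    intro x hx hx'
    rw [mem_block] at hx hx'
    exact sibling_ne hd n b (hx.symm.trans hx')

lemma abs_sub_le_sum_grad (f : (Fin d → ℤ) → ℤ) (i : Fin d) (x : Fin d → ℤ) (r : ℕ) :
    |f (x + Pi.single i (r : ℤ)) - f x|
      ≤ ∑ j ∈ Finset.range r, |grad f i (x + Pi.single i (j : ℤ))| := by
  induction r with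
  | zero => simp
  | succ r ih =>
    rw [Finset.sum_range_succ]
    have h : x + Pi.single i ((r + 1 : ℕ) : ℤ) = x + Pi.single i (r : ℤ) + Pi.single i 1 := by
      rw [add_assoc, ← Pi.single_add]; push_cast; rfl
    rw [h]
    calc |f (x + Pi.single i (r : ℤ) + Pi.single i 1) - f x|
        = |(f (x + Pi.single i (r : ℤ)) - f x) + grad f i (x + Pi.single i (r : ℤ))| := by
          rw [grad]; congr 1; ring
      _ ≤ _ := (abs_add_le _ _).trans (by gcongr)

lemma blockIdx_add_single (n : ℕ) (x : Fin d → ℤ) (i : Fin d) :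
    blockIdx n (x + Pi.single i (2 ^ scale d n i)) = blockIdx n x + Pi.single i 1 := by
  funext k
  by_cases hk : k = i
  · subst hk
    simp only [blockIdx, Pi.add_apply, Pi.single_eq_same]
    rw [Int.add_ediv_of_dvd_right (dvd_refl _), Int.ediv_self (by positivity)]
  · simp [blockIdx, hk]

/-- The number of edges of `K` in direction `i` whose base point lies in the block `c` of the
`n`-th partition. -/
noncomputable def edgeCount (K : Finset ((Fin d → ℤ) × Fin d)) (i : Fin d) (n : ℕ) (c : Fin d → ℤ) : ℕ :=
  (K.filter fun p => p.2 = i ∧ blockIdx n p.1 = c).card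

lemma edgeCount_le_card (K : Finset ((Fin d → ℤ) × Fin d)) (i : Fin d) (n : ℕ) (c : Fin d → ℤ) :
    edgeCount K i n c ≤ K.card := Finset.card_filter_le _ _

/-- An edge of given direction is determined by its base point, so the volume of the block bounds
the count. -/
lemma edgeCount_le_pow (hd : 0 < d) (K : Finset ((Fin d → ℤ) × Fin d)) (i : Fin d) (n : ℕ)
    (c : Fin d → ℤ) : edgeCount K i n c ≤ 2 ^ n := by
  rw [← card_block hd n c]
  refine Finset.card_le_card_of_injOn (fun p => p.1) (fun p hp => ?_) fun p hp q hq h => ?_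
  · simp only [Finset.coe_filter, Set.mem_ofPred_eq] at hp
    exact mem_block.mpr hp.2.2
  · simp only [Finset.coe_filter, Set.mem_ofPred_eq] at hp hq
    exact Prod.ext h (hp.2.1.trans hq.2.1.symm)

/-- A Poincaré inequality for two neighbouring blocks. -/
lemma abs_sum_block_add_sub_le (n : ℕ) {f : (Fin d → ℤ) → ℤ}
    {K : Finset ((Fin d → ℤ) × Fin d)} (hK : ∀ x i, grad f i x ≠ 0 → (x, i) ∈ K)
    (h1 : ∀ x i, |grad f i x| ≤ 1) (b : Fin d → ℤ) (i : Fin d) {M : ℕ}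
    (hM : (K.filter fun p => p.2 = i ∧
      (blockIdx n p.1 = b ∨ blockIdx n p.1 = b + Pi.single i 1)).card ≤ M) :
    |∑ x ∈ block n (b + Pi.single i 1), f x - ∑ x ∈ block n b, f x|
      ≤ 2 ^ scale d n i * M := by
  classical
  -- The second block is a translate of the first by its side length, so the difference becomes a
  -- sum of gradients along segments of that length.
  have hshift : ∑ x ∈ block n (b + Pi.single i 1), f x
      = ∑ x ∈ block n b, f (x + Pi.single i (2 ^ scale d n i)) := by
    symm
    refine Finset.sum_equiv (Equiv.addRight (Pi.single i (2 ^ scale d n i))) (fun x => ?_)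
      fun _ _ => rfl
    rw [mem_block, mem_block, Equiv.coe_addRight, blockIdx_add_single, add_left_inj]
  rw [hshift, ← Finset.sum_sub_distrib]
  obtain ⟨m, hm⟩ : ∃ m : ℕ, m = 2 ^ scale d n i := ⟨_, rfl⟩
  have hcast : (m : ℤ) = 2 ^ scale d n i := by rw [hm]; push_cast; rfl
  calc |∑ x ∈ block n b, (f (x + Pi.single i (2 ^ scale d n i)) - f x)|
      ≤ ∑ x ∈ block n b, ∑ j ∈ Finset.range m,
          |grad f i (x + Pi.single i (j : ℤ))| := by
        refine (Finset.abs_sum_le_sum_abs _ _).trans (Finset.sum_le_sum fun x _ => ?_)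
        rw [← hcast]
        exact abs_sub_le_sum_grad f i x _
    _ = ∑ j ∈ Finset.range m, ∑ x ∈ block n b,
          |grad f i (x + Pi.single i (j : ℤ))| := by rw [Finset.sum_comm]
    -- For fixed `j` the base points are distinct and lie in the two blocks, so each `j` meets at
    -- most `M` edges of `K`.
    _ ≤ ∑ _j ∈ Finset.range m, (M : ℤ) := by
        refine Finset.sum_le_sum fun j hj => ?_
        rw [Finset.mem_range] at hj
        calc ∑ x ∈ block n b, |grad f i (x + Pi.single i (j : ℤ))|
            ≤ ∑ x ∈ block n b, if (x + Pi.single i (j : ℤ), i) ∈ K then 1 else 0 := by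
              refine Finset.sum_le_sum fun x _ => ?_
              split_ifs with h
              · exact h1 _ _
              · have : grad f i (x + Pi.single i (j : ℤ)) = 0 := by
                  by_contra h'
                  exact h (hK _ _ h')
                rw [this, abs_zero]
          _ = (((block n b).filter fun x => (x + Pi.single i (j : ℤ), i) ∈ K).card : ℤ) := by
              rw [Finset.sum_boole]
          _ ≤ M := by
              refine Nat.cast_le.mpr (le_trans ?_ hM)
              refine Finset.card_le_card_of_injOn (fun x => (x + Pi.single i (j : ℤ), i))
                (fun x hx => ?_) fun x _ y _ h => ?_
              · simp only [Finset.coe_filter, Set.mem_ofPred_eq, mem_block] at hx ⊢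
                refine ⟨hx.2, trivial, ?_⟩
                have hoff : ∀ k, k ≠ i → blockIdx n (x + Pi.single i (j : ℤ)) k = b k := by
                  intro k hk
                  rw [← hx.1]
                  simp [blockIdx, hk]
                have hpos : (0 : ℤ) < 2 ^ scale d n i := by positivity
                have hi : x i / 2 ^ scale d n i = b i := by rw [← hx.1]; rfl
                have hon : blockIdx n (x + Pi.single i (j : ℤ)) i = b i ∨
                    blockIdx n (x + Pi.single i (j : ℤ)) i = b i + 1 := by
                  have hj' : (j : ℤ) < 2 ^ scale d n i := by rw [← hcast]; exact_mod_cast hj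
                  have hl : b i ≤ blockIdx n (x + Pi.single i (j : ℤ)) i := by
                    rw [← hi]
                    simp only [blockIdx, Pi.add_apply, Pi.single_eq_same]
                    exact Int.ediv_le_ediv hpos (by omega)
                  have hu : blockIdx n (x + Pi.single i (j : ℤ)) i ≤ b i + 1 := by
                    have h2 : b i + 1 = (x i + 2 ^ scale d n i) / 2 ^ scale d n i := by
                      rw [Int.add_ediv_of_dvd_right (dvd_refl _), Int.ediv_self hpos.ne', hi]
                    rw [h2]
                    simp only [blockIdx, Pi.add_apply, Pi.single_eq_same]
                    exact Int.ediv_le_ediv hpos (by omega)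
                  omega
                rcases hon with h | h
                · left
                  funext k
                  by_cases hk : k = i
                  · rw [hk, h]
                  · exact hoff k hk
                · right
                  funext k
                  by_cases hk : k = i
                  · rw [hk, h]; simp
                  · rw [hoff k hk]; simp [hk]
              · simpa using h
    _ = 2 ^ scale d n i * M := by
        rw [Finset.sum_const, Finset.card_range, nsmul_eq_mul, hcast]

/-- The left side is the difference between the sums over a block and its sibling. These are
neighbours in the merging direction, in which their side is `2 ^ (n / d)`. -/
lemma abs_two_mul_sum_block_sub_le (hd : 0 < d) (n : ℕ) {f : (Fin d → ℤ) → ℤ}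
    {K : Finset ((Fin d → ℤ) × Fin d)} (hK : ∀ x i, grad f i x ≠ 0 → (x, i) ∈ K)
    (h1 : ∀ x i, |grad f i x| ≤ 1) (b : Fin d → ℤ) :
    |2 * ∑ x ∈ block n b, f x - ∑ x ∈ block (n + 1) (parent hd n b), f x|
      ≤ 2 ^ (n / d) * edgeCount K (mergeDir hd n) (n + 1) (parent hd n b) := by
  set i := mergeDir hd n with hi
  have hM : ∀ a a', (∀ y, (y = a ∨ y = a') ↔ (y = b ∨ y = sibling hd n b)) →
      (K.filter fun p => p.2 = i ∧ (blockIdx n p.1 = a ∨ blockIdx n p.1 = a')).card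
        ≤ edgeCount K i (n + 1) (parent hd n b) := by
    intro a a' h
    refine Finset.card_le_card fun p hp => ?_
    rw [Finset.mem_filter] at hp ⊢
    rw [blockIdx_succ hd, parent_eq_parent_iff, ← h]
    exact hp
  rw [sum_block_succ, show ∀ p q : ℤ, 2 * p - (p + q) = p - q by intros; ring,
    ← scale_mergeDir hd n, ← hi]
  by_cases hb : b i % 2 = 0
  · have hs : sibling hd n b = b + Pi.single i 1 := if_pos hb
    rw [hs, abs_sub_comm]
    exact abs_sum_block_add_sub_le n hK h1 b i (hM _ _ fun y => by rw [hs])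
  · have hs : sibling hd n b = b - Pi.single i 1 := if_neg hb
    have hs' : b = sibling hd n b + Pi.single i 1 := by rw [hs, sub_add_cancel]
    have := abs_sum_block_add_sub_le n hK h1 (sibling hd n b) i
      (hM _ _ fun y => by rw [← hs']; tauto)
    rwa [← hs'] at this

end Blocks

end IVGFF

namespace IVGFF

/-! ### Coding of walks and their coarse-graining to cubes -/

section Walks

variable {d : ℕ}

/-- The position after `i` steps of the walk from `z` whose `j`-th step is `c j - 1`. -/
def codedWalk {m : ℕ} (z : Fin d → ℤ) (c : Fin m → Fin d → Fin 3) (i : ℕ) : Fin d → ℤ :=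
  fun k => z k + ∑ j : Fin m, if (j : ℕ) < i then ((c j k : ℕ) : ℤ) - 1 else 0

lemma exists_codedWalk_eq {w : ℕ → Fin d → ℤ} (hw : ∀ t k, |w (t + 1) k - w t k| ≤ 1) (m : ℕ) :
    ∃ c : Fin m → Fin d → Fin 3, ∀ i ≤ m, codedWalk (w 0) c i = w i := by
  have hb : ∀ t k, 0 ≤ w (t + 1) k - w t k + 1 ∧ w (t + 1) k - w t k + 1 < 3 := fun t k => by
    have := abs_le.mp (hw t k)
    omega
  refine ⟨fun j k => ⟨(w (j + 1) k - w j k + 1).toNat, by have := hb j k; omega⟩, fun i => ?_⟩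
  induction i with
  | zero => intro _; funext k; simp [codedWalk]
  | succ i ih =>
    intro hi
    funext k
    have h := congrFun (ih (by omega)) k
    simp only [codedWalk] at h ⊢
    have hsplit : ∀ a : Fin m → ℤ, (∑ j : Fin m, if (j : ℕ) < i + 1 then a j else 0)
        = (∑ j : Fin m, if (j : ℕ) < i then a j else 0) + a ⟨i, hi⟩ := by
      intro a
      have : ∀ j : Fin m, (if (j : ℕ) < i + 1 then a j else 0)
          = (if (j : ℕ) < i then a j else 0) + if j = ⟨i, hi⟩ then a j else 0 := by
        intro j
        by_cases h1 : (j : ℕ) < i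
        · simp [h1, Fin.ext_iff, h1.ne, Nat.lt_succ_of_lt h1]
        · by_cases h2 : (j : ℕ) = i
          · simp [Fin.ext_iff, h2]
          · simp [Fin.ext_iff, h1, h2, show ¬ (j : ℕ) < i + 1 by omega]
      simp_rw [this]
      rw [Finset.sum_add_distrib]
      simp
    rw [hsplit, ← add_assoc, h]
    have := hb i k
    simp only
    omega

lemma abs_walk_sub_le {w : ℕ → Fin d → ℤ} (hw : ∀ t k, |w (t + 1) k - w t k| ≤ 1) (t r : ℕ)
    (k : Fin d) : |w (t + r) k - w t k| ≤ r := by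
  induction r with
  | zero => simp
  | succ r ih =>
    have h := hw (t + r) k
    rw [← add_assoc]
    push_cast
    calc |w (t + r + 1) k - w t k|
        = |(w (t + r) k - w t k) + (w (t + r + 1) k - w (t + r) k)| := by congr 1; ring
      _ ≤ _ := (abs_add_le _ _).trans (by linarith)

lemma abs_ediv_sub_ediv_le {a b q : ℤ} (hq : 0 < q) (h : |a - b| ≤ q) : |a / q - b / q| ≤ 1 := by
  have key : ∀ a b : ℤ, a - b ≤ q → a / q ≤ b / q + 1 := fun a b h => by
    have := Int.ediv_le_ediv hq (show a ≤ b + q by omega)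
    rwa [Int.add_ediv_of_dvd_right (dvd_refl _), Int.ediv_self hq.ne'] at this
  have h' := abs_le.mp h
  have h1 := key a b h'.2
  have h2 := key b a (by omega)
  rw [abs_le]
  omega

/-- Every point that a walk visits before time `q * m` lies in a cube next to one of `m` coded
cubes. -/
lemma exists_cube_walk {w : ℕ → Fin d → ℤ} (hw : ∀ t k, |w (t + 1) k - w t k| ≤ 1) (J m : ℕ) :
    ∃ c : Fin m → Fin d → Fin 3, ∀ t < 2 ^ J * m, ∃ i : Fin m, ∀ k,
      |cubeIdx J (w t) k - codedWalk (cubeIdx J (w 0)) c i k| ≤ 1 := by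
  have hpos : (0 : ℤ) < 2 ^ J := by positivity
  -- Sampled every `2 ^ J` steps, the cube index moves by at most one per coordinate, so the samples
  -- form a coded walk; between samples the position is off by at most one cube.
  have hw' : ∀ i k, |cubeIdx J (w (2 ^ J * (i + 1))) k - cubeIdx J (w (2 ^ J * i)) k| ≤ 1 := by
    intro i k
    refine abs_ediv_sub_ediv_le hpos ?_
    have := abs_walk_sub_le hw (2 ^ J * i) (2 ^ J) k
    rw [mul_add, mul_one]
    exact_mod_cast this
  obtain ⟨c, hc⟩ := exists_codedWalk_eq (w := fun i => cubeIdx J (w (2 ^ J * i))) hw' m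
  refine ⟨c, fun t ht => ?_⟩
  have hlt : t / 2 ^ J < m := Nat.div_lt_of_lt_mul ht
  refine ⟨⟨t / 2 ^ J, hlt⟩, fun k => ?_⟩
  have h := hc (t / 2 ^ J) hlt.le
  simp only [mul_zero] at h
  simp only [h]
  refine abs_ediv_sub_ediv_le hpos ?_
  have h1 := abs_walk_sub_le hw (2 ^ J * (t / 2 ^ J)) (t % 2 ^ J) k
  rw [Nat.div_add_mod] at h1
  refine h1.trans ?_
  have := (Nat.mod_lt t (show 0 < 2 ^ J by positivity)).le
  exact_mod_cast this

end Walks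

/-! ### Multiscale bound on the disorder energy of a contour -/

section ChainingBound

variable {d : ℕ}

/-- The sum of `η` over the sites of `Λ` in the block `b` of the `n`-th partition. -/
noncomputable def blockSum (Λ : Finset (Fin d → ℤ)) (n : ℕ) (b : Fin d → ℤ) (η : Λ → ℝ) : ℝ :=
  ∑ x ∈ Finset.univ.filter fun x : Λ => blockIdx n x.1 = b, η x

/-- The blocks of the `n`-th partition that meet `Λ` inside one of the cubes of side `2 ^ (n + 1)`
next to the coded walk. -/
noncomputable def nearBlocks (Λ : Finset (Fin d → ℤ)) (n : ℕ) {m : ℕ} (z : Fin d → ℤ)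
    (c : Fin m → Fin d → Fin 3) : Finset (Fin d → ℤ) :=
  (Finset.univ.filter fun x : Λ => ∃ i : Fin m, ∀ k,
    |cubeIdx (n + 1) x.1 k - codedWalk z c i k| ≤ 1).image fun x => blockIdx n x.1

/-- The level above which a block sum of the `n`-th partition counts as exceptional. -/
noncomputable def level (T : ℝ) (n : ℕ) : ℝ := T * (n + 1) * Real.sqrt 2 ^ n

/-- The disorder has few exceptional block sums along all walks from `v`, at all scales. -/
def IsRegular (Λ : Finset (Fin d → ℤ)) (v : Fin d → ℤ) (T : ℝ) (η : Λ → ℝ) : Prop :=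
  ∀ n m : ℕ, 1 ≤ m → ∀ c : Fin m → Fin d → Fin 3,
    ∑ b ∈ nearBlocks Λ n (cubeIdx (n + 1) v) c, max (|blockSum Λ n b η| - level T n) 0
      < level T n * m

/-- Dyadic partitions are nested, and no side of a block of the `n`-th partition exceeds `2 ^ n`. -/
lemma cubeIdx_eq_of_blockIdx_eq (hd : 0 < d) {n : ℕ} {x y : Fin d → ℤ}
    (h : blockIdx n x = blockIdx n y) : cubeIdx n x = cubeIdx n y := by
  funext i
  have hi := congrFun h i
  simp only [blockIdx] at hi
  simp only [cubeIdx]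
  obtain ⟨r, hr⟩ := Nat.exists_eq_add_of_le (scale_le hd n i)
  conv_lhs => rw [hr]
  conv_rhs => rw [hr]
  rw [pow_add, ← Int.ediv_ediv_of_nonneg (by positivity), ← Int.ediv_ediv_of_nonneg (by positivity),
    hi]

/-- The factor `2` arises because each edge is counted for both children of the parent block holding
its base point. -/
lemma sum_edgeCount_parent_le (hd : 0 < d) (K : Finset ((Fin d → ℤ) × Fin d)) (n : ℕ) (i : Fin d)
    (B : Finset (Fin d → ℤ)) :
    ∑ b ∈ B, edgeCount K i (n + 1) (parent hd n b) ≤ 2 * K.card := by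
  classical
  calc ∑ b ∈ B, edgeCount K i (n + 1) (parent hd n b)
      ≤ ∑ b ∈ B, ∑ p ∈ K, if blockIdx (n + 1) p.1 = parent hd n b then 1 else 0 := by
        refine Finset.sum_le_sum fun b _ => ?_
        rw [← Finset.card_filter]
        exact Finset.card_le_card (Finset.monotone_filter_right _ fun p _ hp => hp.2)
    _ = ∑ p ∈ K, (B.filter fun b => blockIdx (n + 1) p.1 = parent hd n b).card := by
        rw [Finset.sum_comm]
        simp_rw [Finset.card_filter]
    _ ≤ ∑ _p ∈ K, 2 := by
        refine Finset.sum_le_sum fun p _ => ?_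
        refine (Finset.card_le_card (t := {blockIdx n p.1, sibling hd n (blockIdx n p.1)})
          fun b hb => ?_).trans Finset.card_le_two
        rw [Finset.mem_filter, blockIdx_succ hd] at hb
        have := (parent_eq_parent_iff hd n _ _).mp hb.2.symm
        simpa using this
    _ = 2 * K.card := by rw [Finset.sum_const, smul_eq_mul, mul_comm]

/-- The pairing of `η` and `f` after both are averaged over the blocks of the `n`-th partition. -/
noncomputable def pairing (Λ : Finset (Fin d → ℤ)) (f : (Fin d → ℤ) → ℤ) (η : Λ → ℝ) (n : ℕ) : ℝ :=
  (2 ^ n)⁻¹ * ∑ x : Λ, η x * ((∑ y ∈ block n (blockIdx n x.1), f y : ℤ) : ℝ)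

lemma pairing_zero (Λ : Finset (Fin d → ℤ)) (f : (Fin d → ℤ) → ℤ) (η : Λ → ℝ) :
    pairing Λ f η 0 = ∑ x : Λ, η x * (f x.1 : ℝ) := by
  have : ∀ x : Fin d → ℤ, block 0 (blockIdx 0 x) = {x} := fun x => by
    ext y
    rw [mem_block, blockIdx_zero, blockIdx_zero, Finset.mem_singleton]
  simp [pairing, this]

/-- Block sums of `f` are bounded by its `ℓ¹` norm, while the prefactor decays; hence the
telescoping series recovers the whole pairing at scale `0`. -/
lemma tendsto_pairing (Λ : Finset (Fin d → ℤ)) {f : (Fin d → ℤ) → ℤ} (hf : ∀ x ∉ Λ, f x = 0)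
    (η : Λ → ℝ) : Filter.Tendsto (pairing Λ f η) Filter.atTop (nhds 0) := by
  have hA : ∀ n x, |((∑ y ∈ block n (blockIdx n x), f y : ℤ) : ℝ)| ≤ ∑ y ∈ Λ, |(f y : ℝ)| := by
    intro n x
    rw [← Int.cast_abs]
    have : |∑ y ∈ block n (blockIdx n x), f y| ≤ ∑ y ∈ Λ, |f y| := by
      refine (Finset.abs_sum_le_sum_abs _ _).trans ?_
      rw [← Finset.sum_filter_add_sum_filter_not (block n (blockIdx n x)) (· ∈ Λ)]
      rw [Finset.sum_eq_zero (s := Finset.filter (· ∉ Λ) _) fun y hy => by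
        rw [hf y (Finset.mem_filter.mp hy).2, abs_zero], add_zero]
      exact Finset.sum_le_sum_of_subset_of_nonneg (fun y hy => (Finset.mem_filter.mp hy).2)
        fun _ _ _ => abs_nonneg _
    exact_mod_cast this
  refine squeeze_zero_norm (a := fun n => (2 ^ n)⁻¹ * ∑ x : Λ, |η x| * ∑ y ∈ Λ, |(f y : ℝ)|)
    (fun n => ?_) ?_
  · rw [pairing, Real.norm_eq_abs, abs_mul, abs_of_pos (by positivity : (0 : ℝ) < (2 ^ n)⁻¹)]
    gcongr
    refine (Finset.abs_sum_le_sum_abs _ _).trans (Finset.sum_le_sum fun x _ => ?_)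
    rw [abs_mul]
    gcongr
    exact hA n x.1
  · have h := tendsto_pow_atTop_nhds_zero_of_lt_one (r := (2 : ℝ)⁻¹) (by norm_num) (by norm_num)
    simpa using h.mul_const (∑ x : Λ, |η x| * ∑ y ∈ Λ, |(f y : ℝ)|)

lemma pairing_sub_succ (hd : 0 < d) (Λ : Finset (Fin d → ℤ)) (f : (Fin d → ℤ) → ℤ) (η : Λ → ℝ)
    (n : ℕ) : pairing Λ f η n - pairing Λ f η (n + 1)
      = (2 ^ (n + 1))⁻¹ * ∑ b ∈ Finset.univ.image fun x : Λ => blockIdx n x.1,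
          blockSum Λ n b η * ((2 * ∑ x ∈ block n b, f x
            - ∑ x ∈ block (n + 1) (parent hd n b), f x : ℤ) : ℝ) := by
  classical
  have h1 : ∑ b ∈ Finset.univ.image fun x : Λ => blockIdx n x.1,
      blockSum Λ n b η * ((2 * ∑ x ∈ block n b, f x
        - ∑ x ∈ block (n + 1) (parent hd n b), f x : ℤ) : ℝ)
      = ∑ x : Λ, η x * ((2 * ∑ y ∈ block n (blockIdx n x.1), f y
        - ∑ y ∈ block (n + 1) (parent hd n (blockIdx n x.1)), f y : ℤ) : ℝ) := by
    rw [← Finset.sum_fiberwise_of_maps_to (t := Finset.univ.image fun x : Λ => blockIdx n x.1)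
      (g := fun x : Λ => blockIdx n x.1) fun x _ => Finset.mem_image_of_mem _ (Finset.mem_univ x)]
    refine Finset.sum_congr rfl fun b _ => ?_
    rw [blockSum, Finset.sum_mul]
    refine Finset.sum_congr rfl fun x hx => ?_
    rw [(Finset.mem_filter.mp hx).2]
  rw [h1, pairing, pairing, Finset.mul_sum, Finset.mul_sum, Finset.mul_sum,
    ← Finset.sum_sub_distrib]
  refine Finset.sum_congr rfl fun x _ => ?_
  rw [blockIdx_succ hd]
  push_cast
  rw [pow_succ]
  field_simp

/-- Each `|blockSum|` is split into `level` plus its excess. The level part costs `2 * N` since the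
edge counts sum to at most that. The excess part costs `5 * N`: it is summed over few blocks, each
with at most `min N (2 ^ (n + 1))` edges. Together they give the constant `7`. -/
lemma abs_pairing_sub_succ_le (hd : 0 < d) {Λ : Finset (Fin d → ℤ)} {T : ℝ} (hT : 0 ≤ T)
    {η : Λ → ℝ} {w : ℕ → Fin d → ℤ} (hw : ∀ t k, |w (t + 1) k - w t k| ≤ 1)
    (hη : IsRegular Λ (w 0) T η) {f : (Fin d → ℤ) → ℤ} {K : Finset ((Fin d → ℤ) × Fin d)}
    (hK : ∀ x i, grad f i x ≠ 0 → (x, i) ∈ K) (h1 : ∀ x i, |grad f i x| ≤ 1)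
    (hwK : ∀ p ∈ K, ∃ t ≤ 4 * K.card, p.1 = w t) (n : ℕ) :
    |pairing Λ f η n - pairing Λ f η (n + 1)|
      ≤ (2 ^ (n + 1))⁻¹ * (2 ^ (n / d) * (7 * level T n * K.card)) := by
  classical
  set N := K.card with hN
  set u := level T n with hu
  have hu0 : 0 ≤ u := by rw [hu, level]; positivity
  set i := mergeDir hd n
  set B := Finset.univ.image fun x : Λ => blockIdx n x.1
  set e : (Fin d → ℤ) → ℕ := fun b => edgeCount K i (n + 1) (parent hd n b) with he
  set m := 4 * N / 2 ^ (n + 1) + 1 with hm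
  obtain ⟨c, hc⟩ := exists_cube_walk hw (n + 1) m
  set R := nearBlocks Λ n (cubeIdx (n + 1) (w 0)) c with hR
  have hex := hη n m (Nat.le_add_left _ _) c
  -- An edge in the parent of `b` has its base point on the walk and in the same cube of side `2 ^
  -- (n + 1)` as `b`, so `b` is near the coded walk.
  have hBR : ∀ b ∈ B, b ∉ R → e b = 0 := by
    intro b hb hbR
    by_contra hne
    obtain ⟨p, hp⟩ := Finset.card_pos.mp (Nat.pos_of_ne_zero hne)
    rw [Finset.mem_filter] at hp
    obtain ⟨x, -, rfl⟩ := Finset.mem_image.mp hb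
    obtain ⟨t, ht, hpt⟩ := hwK p hp.1
    have hlt : t < 2 ^ (n + 1) * m := by
      rw [hm]
      exact lt_of_le_of_lt ht (Nat.lt_mul_div_succ _ (by positivity))
    obtain ⟨j, hj⟩ := hc t hlt
    refine hbR (Finset.mem_image.mpr ⟨x, Finset.mem_filter.mpr ⟨Finset.mem_univ _, j, ?_⟩, rfl⟩)
    have hxy : cubeIdx (n + 1) x.1 = cubeIdx (n + 1) (w t) := by
      refine cubeIdx_eq_of_blockIdx_eq hd ?_
      rw [blockIdx_succ hd, ← hp.2.2, hpt]
    rw [hxy]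
    exact hj
  have hsum1 : ∑ b ∈ B, (e b : ℝ) ≤ 2 * N := by
    exact_mod_cast sum_edgeCount_parent_le hd K n i B
  have hmin : ∀ b, (e b : ℝ) ≤ min (N : ℝ) (2 ^ (n + 1)) := fun b => by
    refine le_min ?_ ?_
    · exact_mod_cast edgeCount_le_card K i _ _
    · exact_mod_cast edgeCount_le_pow hd K i _ _
  have hmm : min (N : ℝ) (2 ^ (n + 1)) * m ≤ 5 * N := by
    have h2 : (m : ℝ) ≤ 4 * N / 2 ^ (n + 1) + 1 := by
      rw [hm]
      push_cast
      gcongr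
      have := @Nat.cast_div_le ℝ _ _ _ (4 * N) (2 ^ (n + 1))
      push_cast at this
      exact this
    calc min (N : ℝ) (2 ^ (n + 1)) * m ≤ min (N : ℝ) (2 ^ (n + 1)) * (4 * N / 2 ^ (n + 1) + 1) := by
          gcongr
      _ = min (N : ℝ) (2 ^ (n + 1)) * (4 * N / 2 ^ (n + 1)) + min (N : ℝ) (2 ^ (n + 1)) := by ring
      _ ≤ 2 ^ (n + 1) * (4 * N / 2 ^ (n + 1)) + N := by
          gcongr
          · exact min_le_right _ _
          · exact min_le_left _ _
      _ = 5 * N := by field_simp; ring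
  have hsum2 : ∑ b ∈ B, max (|blockSum Λ n b η| - u) 0 * e b ≤ u * (5 * N) := by
    calc ∑ b ∈ B, max (|blockSum Λ n b η| - u) 0 * e b
        = ∑ b ∈ B.filter (· ∈ R), max (|blockSum Λ n b η| - u) 0 * e b := by
          symm
          refine Finset.sum_filter_of_ne fun b hb hne => ?_
          by_contra hbR
          exact hne (by rw [hBR b hb hbR]; simp)
      _ ≤ ∑ b ∈ R, max (|blockSum Λ n b η| - u) 0 * e b := by
          refine Finset.sum_le_sum_of_subset_of_nonneg
            (fun b hb => (Finset.mem_filter.mp hb).2) fun b _ _ => ?_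
          exact mul_nonneg (le_max_right _ _) (Nat.cast_nonneg _)
      _ ≤ ∑ b ∈ R, max (|blockSum Λ n b η| - u) 0 * min (N : ℝ) (2 ^ (n + 1)) := by
          refine Finset.sum_le_sum fun b _ => ?_
          exact mul_le_mul_of_nonneg_left (hmin b) (le_max_right _ _)
      _ ≤ u * m * min (N : ℝ) (2 ^ (n + 1)) := by
          rw [← Finset.sum_mul]
          gcongr
      _ = u * (min (N : ℝ) (2 ^ (n + 1)) * m) := by ring
      _ ≤ u * (5 * N) := by gcongr
  rw [pairing_sub_succ hd, abs_mul, abs_of_pos (by positivity : (0 : ℝ) < (2 ^ (n + 1))⁻¹)]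
  refine mul_le_mul_of_nonneg_left ?_ (by positivity)
  calc |∑ b ∈ B, blockSum Λ n b η * ((2 * ∑ x ∈ block n b, f x
            - ∑ x ∈ block (n + 1) (parent hd n b), f x : ℤ) : ℝ)|
      ≤ ∑ b ∈ B, (u + max (|blockSum Λ n b η| - u) 0) * (2 ^ (n / d) * e b) := by
        refine (Finset.abs_sum_le_sum_abs _ _).trans (Finset.sum_le_sum fun b _ => ?_)
        rw [abs_mul]
        refine mul_le_mul ?_ ?_ (abs_nonneg _) ?_
        · have := le_max_left (|blockSum Λ n b η| - u) 0
          linarith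
        · rw [← Int.cast_abs]
          exact_mod_cast abs_two_mul_sum_block_sub_le hd n hK h1 b
        · exact add_nonneg hu0 (le_max_right _ _)
    _ = 2 ^ (n / d) * (u * ∑ b ∈ B, (e b : ℝ)
          + ∑ b ∈ B, max (|blockSum Λ n b η| - u) 0 * e b) := by
        rw [Finset.mul_sum, ← Finset.sum_add_distrib, Finset.mul_sum]
        exact Finset.sum_congr rfl fun b _ => by ring
    _ ≤ 2 ^ (n / d) * (u * (2 * N) + u * (5 * N)) := by gcongr
    _ = 2 ^ (n / d) * (7 * u * N) := by ring

/-- The constant in the chaining bound. -/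
noncomputable def chainConst : ℝ :=
  ∑' n : ℕ, 7 / 2 * ((n + 1 : ℝ) * ((2 : ℝ) ^ (1 / 3 : ℝ) / Real.sqrt 2) ^ n)

lemma chainRatio_nonneg : 0 ≤ (2 : ℝ) ^ (1 / 3 : ℝ) / Real.sqrt 2 := by positivity

lemma summable_chain :
    Summable fun n : ℕ => 7 / 2 * ((n + 1 : ℝ) * ((2 : ℝ) ^ (1 / 3 : ℝ) / Real.sqrt 2) ^ n) := by
  have hlt : (2 : ℝ) ^ (1 / 3 : ℝ) / Real.sqrt 2 < 1 := by
    rw [div_lt_one (by positivity), Real.sqrt_eq_rpow]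
    exact Real.rpow_lt_rpow_of_exponent_lt (by norm_num) (by norm_num)
  have h1 := summable_pow_mul_geometric_of_norm_lt_one 1
    (r := (2 : ℝ) ^ (1 / 3 : ℝ) / Real.sqrt 2)
    (by rwa [Real.norm_of_nonneg chainRatio_nonneg])
  have h2 := summable_geometric_of_lt_one chainRatio_nonneg hlt
  refine ((h1.add h2).congr fun n => ?_).mul_left _
  simp only [pow_one]
  ring

lemma chainConst_pos : 0 < chainConst := by
  have hpos : ∀ n : ℕ, 0 < 7 / 2 * ((n + 1 : ℝ) * ((2 : ℝ) ^ (1 / 3 : ℝ) / Real.sqrt 2) ^ n) :=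
    fun n => by positivity
  exact summable_chain.tsum_pos (fun n => (hpos n).le) 0 (hpos 0)

/-- Here `d ≥ 3` matters: `2 ^ (n / d)` is at most `2 ^ (n / 3)`, which is beaten by the remaining
`√2 ^ n` in the denominator. -/
lemma chain_term_le (hd : 3 ≤ d) {T : ℝ} (hT : 0 ≤ T) (n N : ℕ) :
    (2 ^ (n + 1))⁻¹ * (2 ^ (n / d) * (7 * level T n * N))
      ≤ 7 / 2 * ((n + 1 : ℝ) * ((2 : ℝ) ^ (1 / 3 : ℝ) / Real.sqrt 2) ^ n) * (T * N) := by
  have h1 : (2 : ℝ) ^ (n / d) ≤ ((2 : ℝ) ^ (1 / 3 : ℝ)) ^ n := by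
    rw [← Real.rpow_natCast, ← Real.rpow_natCast, ← Real.rpow_mul (by norm_num)]
    refine Real.rpow_le_rpow_of_exponent_le (by norm_num) ?_
    refine Nat.cast_div_le.trans ?_
    rw [div_eq_inv_mul]
    gcongr
    rw [one_div]
    exact inv_anti₀ (by norm_num) (by exact_mod_cast hd)
  have h2 : (2 : ℝ) ^ n = Real.sqrt 2 ^ n * Real.sqrt 2 ^ n := by
    rw [← mul_pow, Real.mul_self_sqrt (by norm_num)]
  calc (2 ^ (n + 1))⁻¹ * (2 ^ (n / d) * (7 * level T n * N))
      ≤ (2 ^ (n + 1))⁻¹ * (((2 : ℝ) ^ (1 / 3 : ℝ)) ^ n * (7 * level T n * N)) := by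
        have : 0 ≤ level T n := by rw [level]; positivity
        gcongr
    _ = _ := by
        rw [level, pow_succ, h2, div_pow]
        have : Real.sqrt 2 ^ n ≠ 0 := by positivity
        field_simp

/-- The chaining bound: regular disorder cannot favour a shift whose gradient is supported on `N`
edges along a walk by more than a multiple of `N`. -/
theorem abs_sum_mul_le_of_isRegular (hd : 3 ≤ d) {Λ : Finset (Fin d → ℤ)} {T : ℝ} (hT : 0 ≤ T)
    {η : Λ → ℝ} {w : ℕ → Fin d → ℤ} (hw : ∀ t k, |w (t + 1) k - w t k| ≤ 1)
    (hη : IsRegular Λ (w 0) T η) {f : (Fin d → ℤ) → ℤ} (hf : ∀ x ∉ Λ, f x = 0)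
    {K : Finset ((Fin d → ℤ) × Fin d)}
    (hK : ∀ x i, grad f i x ≠ 0 → (x, i) ∈ K) (h1 : ∀ x i, |grad f i x| ≤ 1)
    (hwK : ∀ p ∈ K, ∃ t ≤ 4 * K.card, p.1 = w t) :
    |∑ x : Λ, η x * (f x.1 : ℝ)| ≤ chainConst * (T * K.card) := by
  have hd0 : 0 < d := by omega
  rw [← pairing_zero]
  have hstep : ∀ n, |pairing Λ f η 0| ≤ |pairing Λ f η n| + chainConst * (T * K.card) := by
    intro n
    have htel : ∀ n, |pairing Λ f η 0 - pairing Λ f η n|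
        ≤ ∑ k ∈ Finset.range n, |pairing Λ f η k - pairing Λ f η (k + 1)| := by
      intro n
      rw [← Finset.sum_range_sub']
      exact Finset.abs_sum_le_sum_abs _ _
    have h2 : ∑ k ∈ Finset.range n, |pairing Λ f η k - pairing Λ f η (k + 1)|
        ≤ chainConst * (T * K.card) := by
      calc _ ≤ ∑ k ∈ Finset.range n, 7 / 2 * ((k + 1 : ℝ)
              * ((2 : ℝ) ^ (1 / 3 : ℝ) / Real.sqrt 2) ^ k) * (T * K.card) :=
            Finset.sum_le_sum fun k _ =>
              (abs_pairing_sub_succ_le hd0 hT hw hη hK h1 hwK k).trans (chain_term_le hd hT k _)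
        _ ≤ _ := by
            rw [← Finset.sum_mul]
            refine mul_le_mul_of_nonneg_right ?_ (by positivity)
            exact summable_chain.sum_le_tsum _ fun k _ => by positivity
    have h3 := abs_sub_abs_le_abs_sub (pairing Λ f η 0) (pairing Λ f η n)
    linarith [htel n]
  have hlim := ((tendsto_pairing Λ hf η).abs.add_const (chainConst * (T * K.card)))
  rw [abs_zero, zero_add] at hlim
  exact ge_of_tendsto' hlim hstep

end ChainingBound

end IVGFF

namespace IVGFF

/-! ### Gaussian disorder is regular with high probability -/

section Regularity

variable {d : ℕ}

/-- Counts sites instead of blocks: a cube together with its neighbours has side `3 * 2 ^ (n + 1)`.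
-/
lemma card_nearBlocks_le (Λ : Finset (Fin d → ℤ)) (n : ℕ) {m : ℕ} (z : Fin d → ℤ)
    (c : Fin m → Fin d → Fin 3) : (nearBlocks Λ n z c).card ≤ m * (3 * 2 ^ (n + 1)) ^ d := by
  classical
  have hpos : (0 : ℤ) < 2 ^ (n + 1) := by positivity
  let D : Fin m → Finset (Fin d → ℤ) := fun i => Fintype.piFinset fun k =>
    Finset.Ico ((codedWalk z c i k - 1) * 2 ^ (n + 1)) ((codedWalk z c i k + 2) * 2 ^ (n + 1))
  have hD : ∀ i, (D i).card = (3 * 2 ^ (n + 1)) ^ d := by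
    intro i
    simp only [D, Fintype.card_piFinset, Int.card_Ico]
    rw [Finset.prod_congr rfl fun k _ => show ((codedWalk z c i k + 2) * 2 ^ (n + 1)
        - (codedWalk z c i k - 1) * 2 ^ (n + 1)).toNat = 3 * 2 ^ (n + 1) by
      rw [← sub_mul, show codedWalk z c i k + 2 - (codedWalk z c i k - 1) = 3 by ring]
      norm_cast]
    simp
  calc (nearBlocks Λ n z c).card ≤ (Finset.univ.biUnion D).card := by
        refine Finset.card_image_le.trans ?_
        refine Finset.card_le_card_of_injOn (fun x => x.1) (fun x hx => ?_)
          Subtype.val_injective.injOn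
        simp only [Finset.coe_filter, Set.mem_ofPred_eq, Finset.mem_univ, true_and] at hx
        obtain ⟨i, hi⟩ := hx
        refine Finset.mem_coe.mpr (Finset.mem_biUnion.mpr ⟨i, Finset.mem_univ _, ?_⟩)
        refine Fintype.mem_piFinset.mpr fun k => ?_
        have h := abs_le.mp (hi k)
        have h1 : codedWalk z c i k - 1 ≤ x.1 k / 2 ^ (n + 1) := by
          have := h.1; simp only [cubeIdx] at this; omega
        have h2 : x.1 k / 2 ^ (n + 1) < codedWalk z c i k + 2 := by
          have := h.2; simp only [cubeIdx] at this; omega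
        exact Finset.mem_Ico.mpr ⟨(Int.le_ediv_iff_mul_le hpos).mp h1,
          (Int.ediv_lt_iff_lt_mul hpos).mp h2⟩
    _ ≤ ∑ i : Fin m, (D i).card := Finset.card_biUnion_le
    _ = m * (3 * 2 ^ (n + 1)) ^ d := by simp [hD]

/-- The factor `n + 1` in `level` pays for this: the Gaussian tail then decays like a power `n + 1`
of `exp (-T ^ 2 / 2)` and absorbs the number of sites in a cube, even counted so crudely. -/
lemma exceptional_le {T : ℝ} (hT : (6 : ℝ) ^ (d + 1) ≤ Real.exp (T ^ 2 / 2)) (n : ℕ) :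
    2 * Real.exp (-(T ^ 2 * (n + 1) ^ 2) / 2) * (3 * 2 ^ (n + 1)) ^ d ≤ 1 := by
  have h1 : Real.exp (-(T ^ 2 * (n + 1) ^ 2) / 2) ≤ (Real.exp (T ^ 2 / 2) ^ (n + 1))⁻¹ := by
    rw [← Real.exp_nat_mul, ← Real.exp_neg, Real.exp_le_exp]
    have : (n + 1 : ℝ) ≤ (n + 1) ^ 2 := by nlinarith [(Nat.cast_nonneg n : (0 : ℝ) ≤ n)]
    push_cast
    nlinarith [sq_nonneg T]
  have h2 : (2 : ℝ) * (3 * 2 ^ (n + 1)) ^ d ≤ Real.exp (T ^ 2 / 2) ^ (n + 1) := by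
    calc (2 : ℝ) * (3 * 2 ^ (n + 1)) ^ d = (2 * 3 ^ d) * (2 ^ d) ^ (n + 1) := by
          rw [mul_pow, ← pow_mul, ← pow_mul, mul_comm d (n + 1)]; ring
      _ ≤ (2 * 3 ^ d) ^ (n + 1) * (2 ^ d) ^ (n + 1) := by
          gcongr
          refine le_self_pow₀ ?_ (by omega)
          have : (1 : ℝ) ≤ 3 ^ d := one_le_pow₀ (by norm_num)
          linarith
      _ = (2 * 6 ^ d) ^ (n + 1) := by
          rw [← mul_pow, mul_assoc, ← mul_pow]; norm_num
      _ ≤ (6 ^ (d + 1)) ^ (n + 1) := by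
          gcongr
          rw [pow_succ']
          gcongr
          norm_num
      _ ≤ _ := by gcongr
  calc _ ≤ 2 * (Real.exp (T ^ 2 / 2) ^ (n + 1))⁻¹ * (3 * 2 ^ (n + 1)) ^ d := by gcongr
    _ = (Real.exp (T ^ 2 / 2) ^ (n + 1))⁻¹ * (2 * (3 * 2 ^ (n + 1)) ^ d) := by ring
    _ ≤ (Real.exp (T ^ 2 / 2) ^ (n + 1))⁻¹ * Real.exp (T ^ 2 / 2) ^ (n + 1) := by gcongr
    _ = 1 := inv_mul_cancel₀ (by positivity)

/-- With `a = exp (-T ^ 2 / 2)`, the probability is at most `(a * a ^ (n + 1)) ^ (m + 1)`. One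
factor `a` per cube absorbs the `3 ^ d` choices of a step and the factor `e`; the others make the
sum over `n` and `m` converge. -/
lemma union_term_le {T : ℝ} (hT : (6 : ℝ) ^ (d + 1) ≤ Real.exp (T ^ 2 / 2)) (n m : ℕ) :
    ((3 : ℝ) ^ d) ^ (m + 1) * (Real.exp (-(T ^ 2 * (n + 1) ^ 2 * (m + 1))) * Real.exp (m + 1))
      ≤ Real.exp (-(T ^ 2 / 2)) * ((1 / 2) ^ n * (1 / 2) ^ m) := by
  set a := Real.exp (-(T ^ 2 / 2)) with ha
  have ha0 : 0 < a := Real.exp_pos _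
  have hinv : Real.exp (T ^ 2 / 2) = a⁻¹ := by rw [ha, Real.exp_neg, inv_inv]
  rw [hinv] at hT
  have h6 : (6 : ℝ) ≤ 6 ^ (d + 1) := le_self_pow₀ (by norm_num) (by omega)
  have ha2 : a ≤ 1 / 2 := by
    have := (le_inv_comm₀ (by norm_num) ha0).mp (h6.trans hT)
    linarith
  have h3 : (3 : ℝ) ^ d * Real.exp 1 * a ≤ 1 := by
    rw [← le_div_iff₀ ha0, one_div]
    refine le_trans ?_ hT
    calc (3 : ℝ) ^ d * Real.exp 1 ≤ 6 ^ d * 6 := by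
          gcongr
          · norm_num
          · have := Real.exp_one_lt_d9; linarith
      _ = 6 ^ (d + 1) := (pow_succ _ _).symm
  have hexp : Real.exp (-(T ^ 2 * (n + 1) ^ 2 * (m + 1))) ≤ (a * a ^ (n + 1)) ^ (m + 1) := by
    rw [← pow_succ', ha, ← Real.exp_nat_mul, ← Real.exp_nat_mul, Real.exp_le_exp]
    push_cast
    have hn : (n + 1 + 1 : ℝ) / 2 ≤ (n + 1) ^ 2 := by
      nlinarith [(Nat.cast_nonneg n : (0 : ℝ) ≤ n)]
    have hm : (0 : ℝ) ≤ T ^ 2 * (m + 1) := by positivity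
    nlinarith [mul_le_mul_of_nonneg_left hn hm]
  calc ((3 : ℝ) ^ d) ^ (m + 1) * (Real.exp (-(T ^ 2 * (n + 1) ^ 2 * (m + 1))) * Real.exp (m + 1))
      ≤ ((3 : ℝ) ^ d) ^ (m + 1) * ((a * a ^ (n + 1)) ^ (m + 1) * Real.exp 1 ^ (m + 1)) := by
        gcongr
        rw [← Real.exp_nat_mul]
        push_cast
        rw [mul_one]
    _ = (3 ^ d * Real.exp 1 * a) ^ (m + 1) * (a ^ (n + 1)) ^ (m + 1) := by
        rw [← mul_pow, ← mul_pow, ← mul_pow]; ring_nf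
    _ ≤ 1 * a ^ (1 + (n + m)) := by
        gcongr
        · exact pow_le_one₀ (by positivity) h3
        · rw [← pow_mul]
          refine pow_le_pow_of_le_one ha0.le (by linarith) ?_
          nlinarith [Nat.zero_le (n * m)]
    _ = a * (a ^ n * a ^ m) := by rw [one_mul, pow_add, pow_one, pow_add]
    _ ≤ _ := by gcongr

/-- Union bound over scales, lengths and coarse walks; the two geometric series give the factor `4`.
-/
lemma measure_not_isRegular_le (hd : 0 < d) (Λ : Finset (Fin d → ℤ)) (v : Fin d → ℤ) {T : ℝ}
    (hT0 : 0 ≤ T) (hT : (6 : ℝ) ^ (d + 1) ≤ Real.exp (T ^ 2 / 2)) {Ω : Type*} [MeasurableSpace Ω]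
    {P : Measure Ω} [IsProbabilityMeasure P] {Y : Λ → Ω → ℝ} (hi : iIndepFun Y P)
    (hm : ∀ i, Measurable (Y i)) (hl : ∀ i, P.map (Y i) = gaussianReal 0 1) :
    P {ω | ¬ IsRegular Λ v T fun x => Y x ω} ≤ ENNReal.ofReal (4 * Real.exp (-(T ^ 2 / 2))) := by
  classical
  let E : (n m : ℕ) → (Fin (m + 1) → Fin d → Fin 3) → Set Ω := fun n m c =>
    {ω | level T n * (m + 1) ≤ ∑ b ∈ nearBlocks Λ n (cubeIdx (n + 1) v) c,
      max (|blockSum Λ n b fun x => Y x ω| - level T n) 0}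
  have hsub : {ω | ¬ IsRegular Λ v T fun x => Y x ω} ⊆ ⋃ n, ⋃ m, ⋃ c, E n m c := by
    intro ω hω
    simp only [Set.mem_ofPred_eq, IsRegular, not_forall, not_lt] at hω
    obtain ⟨n, m, hm1, c, h⟩ := hω
    obtain ⟨k, rfl⟩ := Nat.exists_eq_add_of_le' hm1
    simp only [Set.mem_iUnion]
    refine ⟨n, k, c, ?_⟩
    simpa [E] using h
  have hE : ∀ n m c, P (E n m c) ≤ ENNReal.ofReal
      (Real.exp (-(T ^ 2 * (n + 1) ^ 2 * (m + 1))) * Real.exp (m + 1)) := by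
    intro n m c
    have hlev : 0 ≤ level T n := by rw [level]; positivity
    have hsq : level T n ^ 2 = T ^ 2 * (n + 1) ^ 2 * 2 ^ n := by
      rw [level, mul_pow, mul_pow, ← pow_mul, mul_comm n 2, pow_mul, Real.sq_sqrt (by norm_num)]
    refine (measure_excess_le hi hm hl (nearBlocks Λ n (cubeIdx (n + 1) v) c)
      (fun b => Finset.univ.filter fun x : Λ => blockIdx n x.1 = b) ?_ (V := 2 ^ n)
      (by positivity) ?_ hlev (level T n * (m + 1))).trans (ENNReal.ofReal_le_ofReal ?_)
    · intro b _ b' _ hbb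
      rw [Function.onFun, Finset.disjoint_left]
      intro x hx hx'
      rw [Finset.mem_filter] at hx hx'
      exact hbb (hx.2.symm.trans hx'.2)
    · intro b _
      have : (Finset.univ.filter fun x : Λ => blockIdx n x.1 = b).card ≤ 2 ^ n := by
        rw [← card_block hd n b]
        refine Finset.card_le_card_of_injOn (fun x => x.1) (fun x hx => ?_)
          Subtype.val_injective.injOn
        exact mem_block.mpr (Finset.mem_filter.mp hx).2
      exact_mod_cast this
    · refine mul_le_mul (le_of_eq ?_) ?_ (by positivity) (by positivity)
      · congr 2
        have : (2 : ℝ) ^ n ≠ 0 := by positivity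
        rw [div_mul_eq_mul_div, ← mul_assoc, ← sq, hsq]
        field_simp
      · have he : -level T n ^ 2 / (2 * 2 ^ n) = -(T ^ 2 * (n + 1) ^ 2) / 2 := by
          rw [hsq]; field_simp
        rw [he]
        set ε := 2 * Real.exp (-(T ^ 2 * (n + 1) ^ 2) / 2) with hε
        have hε0 : 0 ≤ ε := by positivity
        calc (1 + ε) ^ (nearBlocks Λ n (cubeIdx (n + 1) v) c).card
            ≤ Real.exp ε ^ (nearBlocks Λ n (cubeIdx (n + 1) v) c).card := by
              gcongr
              rw [add_comm]
              exact Real.add_one_le_exp ε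
          _ = Real.exp ((nearBlocks Λ n (cubeIdx (n + 1) v) c).card * ε) :=
              (Real.exp_nat_mul _ _).symm
          _ ≤ Real.exp (m + 1) := by
              refine Real.exp_le_exp.mpr ?_
              have hcard : ((nearBlocks Λ n (cubeIdx (n + 1) v) c).card : ℝ)
                  ≤ (m + 1) * (3 * 2 ^ (n + 1)) ^ d := by
                exact_mod_cast card_nearBlocks_le Λ n (cubeIdx (n + 1) v) c
              calc _ ≤ (m + 1) * (3 * 2 ^ (n + 1)) ^ d * ε := by gcongr
                _ = (m + 1) * (ε * (3 * 2 ^ (n + 1)) ^ d) := by ring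
                _ ≤ (m + 1) * 1 := by
                    gcongr
                    exact exceptional_le hT n
                _ = m + 1 := mul_one _
  have hEc : ∀ n m, ∑' c, P (E n m c) ≤ ENNReal.ofReal (Real.exp (-(T ^ 2 / 2)))
      * (2⁻¹ ^ n * 2⁻¹ ^ m) := by
    intro n m
    have h2 : (2⁻¹ : ENNReal) = ENNReal.ofReal (1 / 2) := by
      rw [one_div, ENNReal.ofReal_inv_of_pos (by norm_num)]; simp
    calc ∑' c, P (E n m c) ≤ ∑' _c : Fin (m + 1) → Fin d → Fin 3, ENNReal.ofReal
          (Real.exp (-(T ^ 2 * (n + 1) ^ 2 * (m + 1))) * Real.exp (m + 1)) :=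
          ENNReal.tsum_le_tsum fun c => hE n m c
      _ = ENNReal.ofReal (((3 : ℝ) ^ d) ^ (m + 1)
            * (Real.exp (-(T ^ 2 * (n + 1) ^ 2 * (m + 1))) * Real.exp (m + 1))) := by
          rw [tsum_fintype, Finset.sum_const, Finset.card_univ, nsmul_eq_mul,
            ENNReal.ofReal_mul (p := ((3 : ℝ) ^ d) ^ (m + 1)) (by positivity)]
          congr 1
          rw [ENNReal.ofReal_pow (by positivity), ENNReal.ofReal_pow (by positivity)]
          simp
      _ ≤ ENNReal.ofReal (Real.exp (-(T ^ 2 / 2)) * ((1 / 2) ^ n * (1 / 2) ^ m)) :=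
          ENNReal.ofReal_le_ofReal (union_term_le hT n m)
      _ = _ := by
          rw [ENNReal.ofReal_mul (by positivity), ENNReal.ofReal_mul (by positivity),
            ENNReal.ofReal_pow (by positivity), ENNReal.ofReal_pow (by positivity), h2]
  calc P {ω | ¬ IsRegular Λ v T fun x => Y x ω} ≤ P (⋃ n, ⋃ m, ⋃ c, E n m c) := measure_mono hsub
    _ ≤ ∑' n, ∑' m, ∑' c, P (E n m c) := by
        refine (measure_iUnion_le _).trans (ENNReal.tsum_le_tsum fun n => ?_)
        refine (measure_iUnion_le _).trans (ENNReal.tsum_le_tsum fun m => ?_)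
        exact measure_iUnion_le _
    _ ≤ ∑' n, ∑' m, ENNReal.ofReal (Real.exp (-(T ^ 2 / 2))) * (2⁻¹ ^ n * 2⁻¹ ^ m) :=
        ENNReal.tsum_le_tsum fun n => ENNReal.tsum_le_tsum fun m => hEc n m
    _ = ENNReal.ofReal (4 * Real.exp (-(T ^ 2 / 2))) := by
        simp_rw [ENNReal.tsum_mul_left, ENNReal.tsum_mul_right, ENNReal.tsum_geometric,
          ENNReal.one_sub_inv_two, inv_inv]
        rw [mul_comm 4, ENNReal.ofReal_mul (by positivity)]
        norm_num

/-- Independent standard Gaussian disorder is regular with high probability. -/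
theorem prob_not_isRegular_le (hd : 0 < d) (Λ : Finset (Fin d → ℤ)) (v : Fin d → ℤ) {T : ℝ}
    (hT0 : 0 ≤ T) (hT : (6 : ℝ) ^ (d + 1) ≤ Real.exp (T ^ 2 / 2)) {Ω : Type*} [MeasurableSpace Ω]
    {P : Measure Ω} [IsProbabilityMeasure P] {η : Λ → Ω → ℝ}
    (hl : ∀ x, HasLaw (η x) (gaussianReal 0 1) P) (hi : iIndepFun η P) :
    P {ω | ¬ IsRegular Λ v T fun x => η x ω} ≤ ENNReal.ofReal (4 * Real.exp (-(T ^ 2 / 2))) := by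
  -- The variables are only a.e. measurable, so the estimate is proved for the coordinates of the
  -- product space and pulled back by `Measure.le_map_apply`, which needs no measurability of the
  -- event.
  have hae : ∀ x, AEMeasurable (η x) P := fun x => (hl x).aemeasurable
  have hmap := (iIndepFun_iff_map_fun_eq_pi_map hae).mp hi
  simp_rw [fun x => (hl x).map_eq] at hmap
  have hY : iIndepFun (fun (x : Λ) (z : Λ → ℝ) => z x)
      (Measure.pi fun _ : Λ => gaussianReal 0 1) :=
    iIndepFun_pi (X := fun _ : Λ => fun t : ℝ => t) fun _ => aemeasurable_id
  have hmeas := measure_not_isRegular_le hd Λ v hT0 hT hY (fun x => measurable_pi_apply x)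
    fun x => (measurePreserving_eval (fun _ : Λ => gaussianReal 0 1) x).map_eq
  rw [← hmap] at hmeas
  exact (Measure.le_map_apply (aemeasurable_pi_lambda _ hae) _).trans hmeas

end Regularity

end IVGFF

namespace IVGFF

/-! ### Extraction of a contour around a nonzero height -/

section Contours

variable {d : ℕ}

/-- A finite set that is connected through steps of size one in the sup-norm is covered by a walk
whose length is at most twice its size. -/
lemma exists_covering_walk {v : Fin d → ℤ} {S : Finset (Fin d → ℤ)} (hv : v ∈ S)
    (hconn : ∀ s ∈ S,
      Relation.ReflTransGen (fun a b => b ∈ S ∧ ∀ k, |b k - a k| ≤ 1) v s) :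
    ∃ w : ℕ → Fin d → ℤ, w 0 = v ∧ (∀ t k, |w (t + 1) k - w t k| ≤ 1) ∧
      ∀ s ∈ S, ∃ t ≤ 2 * S.card, s = w t := by
  classical
  have key : ∀ n, n + 1 ≤ S.card → ∃ T ⊆ S, v ∈ T ∧ T.card = n + 1 ∧
      ∃ w : ℕ → Fin d → ℤ, w 0 = v ∧ (∀ t k, |w (t + 1) k - w t k| ≤ 1) ∧
        ∀ s ∈ T, ∃ t ≤ 2 * n, s = w t := by
    intro n
    induction n with
    | zero =>
      intro _
      exact ⟨{v}, by simpa using hv, by simp, by simp, fun _ => v, rfl, by simp, by simp⟩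
    | succ n ih =>
      intro hn
      obtain ⟨T, hTS, hvT, hTc, w, hw0, hw, hcov⟩ := ih (by omega)
      obtain ⟨x, hx, y, hyS, hyT, hxy⟩ : ∃ x ∈ T, ∃ y ∈ S, y ∉ T ∧ ∀ k, |y k - x k| ≤ 1 := by
        by_contra! hcon
        have hST : S ⊆ T := by
          intro s hs
          induction hconn s hs with
          | refl => exact hvT
          | @tail a b hva hab ih' =>
            by_contra hbT
            have ha : a ∈ T := by
              rcases Relation.ReflTransGen.cases_tail hva with h | ⟨_, _, h⟩
              · rw [h]; exact hvT
              · exact ih' h.1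
            obtain ⟨k, hk⟩ := hcon a ha b hab.1 hbT
            exact absurd (hab.2 k) (not_le.mpr hk)
        have := Finset.card_le_card hST
        omega
      obtain ⟨t₀, ht₀, rfl⟩ := hcov x hx
      -- Insert a detour: at time `t₀` step to `y` and back, delaying the rest of the walk by two.
      refine ⟨insert y T, Finset.insert_subset hyS hTS, Finset.mem_insert_of_mem hvT,
        by rw [Finset.card_insert_of_notMem hyT, hTc],
        fun t => if t ≤ t₀ then w t else if t = t₀ + 1 then y else w (t - 2), by simp [hw0], ?_, ?_⟩
      · intro t k
        rcases lt_trichotomy t t₀ with h | rfl | h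
        · simp only [h.le, if_true, show t + 1 ≤ t₀ by omega]
          exact hw t k
        · simp only [le_refl, if_true, show ¬ t + 1 ≤ t by omega, if_false]
          exact hxy k
        · obtain ⟨r, rfl⟩ := Nat.exists_eq_add_of_lt h
          rcases r with _ | r
          · simp only [show ¬ t₀ + 0 + 1 + 1 ≤ t₀ by omega, show ¬ t₀ + 0 + 1 ≤ t₀ by omega,
              show ¬ t₀ + 0 + 1 + 1 = t₀ + 1 by omega, if_false, add_zero, if_true,
              show t₀ + 1 + 1 - 2 = t₀ by omega]
            rw [abs_sub_comm]
            exact hxy k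
          · simp only [show ¬ t₀ + (r + 1) + 1 + 1 ≤ t₀ by omega,
              show ¬ t₀ + (r + 1) + 1 ≤ t₀ by omega,
              show ¬ t₀ + (r + 1) + 1 + 1 = t₀ + 1 by omega,
              show ¬ t₀ + (r + 1) + 1 = t₀ + 1 by omega, if_false,
              show t₀ + (r + 1) + 1 + 1 - 2 = t₀ + r + 1 by omega,
              show t₀ + (r + 1) + 1 - 2 = t₀ + r by omega]
            exact hw (t₀ + r) k
      · intro s hs
        rcases Finset.mem_insert.mp hs with rfl | hs
        · exact ⟨t₀ + 1, by omega, by simp⟩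
        · obtain ⟨t, ht, rfl⟩ := hcov s hs
          by_cases h : t ≤ t₀
          · exact ⟨t, by omega, by simp [h]⟩
          · refine ⟨t + 2, by omega, ?_⟩
            simp [show ¬ t + 2 ≤ t₀ by omega, show ¬ t + 2 = t₀ + 1 by omega]
  have hpos : 0 < S.card := Finset.card_pos.mpr ⟨v, hv⟩
  obtain ⟨T, hTS, -, hTc, w, hw0, hw, hcov⟩ := key (S.card - 1) (by omega)
  have hT : T = S := Finset.eq_of_subset_of_card_le hTS (by omega)
  refine ⟨w, hw0, hw, fun s hs => ?_⟩
  obtain ⟨t, ht, hst⟩ := hcov s (hT ▸ hs)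
  exact ⟨t, by omega, hst⟩

lemma sum_grad (f : (Fin d → ℤ) → ℤ) (i : Fin d) (x : Fin d → ℤ) (n : ℕ) :
    ∑ k ∈ Finset.range n, grad f i (x + Pi.single i (k : ℤ)) = f (x + Pi.single i (n : ℤ)) - f x := by
  induction n with
  | zero => simp
  | succ n ih =>
    rw [Finset.sum_range_succ, ih, grad, add_assoc, ← Pi.single_add]
    push_cast
    ring

/-- A discrete one-form that vanishes far out in direction `i₀` and is closed on the plaquettes
in the directions `i₀, j` is exact. -/
lemma exists_grad_eq (i₀ : Fin d) {ω : (Fin d → ℤ) → Fin d → ℤ} {M : ℤ}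
    (hM : ∀ x i, M ≤ x i₀ → ω x i = 0)
    (hclosed : ∀ x j, ω x i₀ + ω (x + Pi.single i₀ 1) j = ω x j + ω (x + Pi.single j 1) i₀) :
    ∃ f : (Fin d → ℤ) → ℤ, (∀ x i, grad f i x = ω x i) ∧ ∀ x, M ≤ x i₀ → f x = 0 := by
  -- Integrate the form from infinity along the ray in direction `i₀`. Neighbouring rays are
  -- compared through the plaquettes between them, so only plaquettes containing the direction `i₀`
  -- are needed.
  let f : (Fin d → ℤ) → ℤ := fun x =>
    -∑ k ∈ Finset.range (M - x i₀).toNat, ω (x + Pi.single i₀ (k : ℤ)) i₀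
  have hf : ∀ x (n : ℕ), M ≤ x i₀ + n →
      f x = -∑ k ∈ Finset.range n, ω (x + Pi.single i₀ (k : ℤ)) i₀ := by
    intro x n hn
    simp only [f]
    congr 1
    refine Finset.sum_subset (Finset.range_subset_range.mpr (by omega)) fun k _ hk => hM _ _ ?_
    rw [Finset.mem_range, not_lt] at hk
    simp only [Pi.add_apply, Pi.single_eq_same]
    omega
  refine ⟨f, fun x j => ?_, fun x hx => by rw [hf x 0 (by simpa using hx)]; simp⟩
  set n := (M - x i₀).toNat with hn
  have hn' : M ≤ x i₀ + n := by omega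
  have hxj : x i₀ ≤ (x + Pi.single j 1 : Fin d → ℤ) i₀ := by
    by_cases h : i₀ = j
    · subst h; simp
    · simp [h]
  rw [grad, hf x n hn', hf (x + Pi.single j 1) n (by omega), sub_neg_eq_add, neg_add_eq_sub,
    ← Finset.sum_sub_distrib]
  have hterm : ∀ k : ℕ, ω (x + Pi.single i₀ (k : ℤ)) i₀
      - ω (x + Pi.single j 1 + Pi.single i₀ (k : ℤ)) i₀
      = ω (x + Pi.single i₀ (k : ℤ)) j - ω (x + Pi.single i₀ ((k + 1 : ℕ) : ℤ)) j := by
    intro k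
    have h := hclosed (x + Pi.single i₀ (k : ℤ)) j
    have h1 : x + Pi.single i₀ (k : ℤ) + Pi.single i₀ 1 = x + Pi.single i₀ ((k + 1 : ℕ) : ℤ) := by
      rw [add_assoc, ← Pi.single_add]; push_cast; rfl
    rw [h1, add_right_comm x] at h
    linarith
  simp_rw [hterm]
  have hend : ω (x + Pi.single i₀ (n : ℤ)) j = 0 := hM _ _ (by simpa using hn')
  refine (Finset.sum_range_sub' (fun k : ℕ => ω (x + Pi.single i₀ (k : ℤ)) j) n).trans ?_
  simp [hend]

/-- The edges of the plaquette at `x` in the directions `i₀, j`. -/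
def plaquette (i₀ : Fin d) (x : Fin d → ℤ) (j : Fin d) : Set ((Fin d → ℤ) × Fin d) :=
  {(x, i₀), (x + Pi.single i₀ 1, j), (x, j), (x + Pi.single j 1, i₀)}

/-- Two edges on which `u` is not constant are linked if they belong to a common plaquette. -/
def Linked (i₀ : Fin d) (u : (Fin d → ℤ) → ℤ) (p q : (Fin d → ℤ) × Fin d) : Prop :=
  grad u p.2 p.1 ≠ 0 ∧ grad u q.2 q.1 ≠ 0 ∧ ∃ x j, p ∈ plaquette i₀ x j ∧ q ∈ plaquette i₀ x j

lemma Linked.symm {i₀ : Fin d} {u : (Fin d → ℤ) → ℤ} {p q : (Fin d → ℤ) × Fin d}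
    (h : Linked i₀ u p q) : Linked i₀ u q p :=
  ⟨h.2.1, h.1, h.2.2.imp fun _ => Exists.imp fun _ hx => hx.symm⟩

/-- The equivalence relation generated by `Linked`. -/
def linkedSetoid (i₀ : Fin d) (u : (Fin d → ℤ) → ℤ) : Setoid ((Fin d → ℤ) × Fin d) where
  r := Relation.ReflTransGen (Linked i₀ u)
  iseqv := ⟨fun _ => .refl, fun h => by
    have : Std.Symm (Linked i₀ u) := ⟨fun _ _ => Linked.symm⟩
    exact Std.Symm.symm _ _ h, .trans⟩

/-- Makes a class of linked edges connected through sup-norm steps of size one, as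
`exists_covering_walk` requires. -/
lemma near_of_mem_plaquette {i₀ j : Fin d} {x : Fin d → ℤ} {p q : (Fin d → ℤ) × Fin d}
    (hp : p ∈ plaquette i₀ x j) (hq : q ∈ plaquette i₀ x j) (k : Fin d) :
    |q.1 k - p.1 k| ≤ 1 := by
  have key : ∀ p ∈ plaquette i₀ x j, p.1 k = x k ∨ p.1 k = x k + 1 := by
    intro p hp
    rcases hp with rfl | rfl | rfl | rfl <;> simp [Pi.single_apply] <;>
      tauto
  have h1 := key p hp
  have h2 := key q hq
  rw [abs_le]
  omega

open Classical in
/-- The gradient of `u`, restricted to one class of linked edges. -/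
noncomputable def classGrad (i₀ : Fin d) (u : (Fin d → ℤ) → ℤ) (c : Quotient (linkedSetoid i₀ u))
    (x : Fin d → ℤ) (i : Fin d) : ℤ :=
  if Quotient.mk (linkedSetoid i₀ u) (x, i) = c then grad u i x else 0

/-- All edges of a plaquette where `u` jumps are linked to one another. So a class carries either
the full gradient of `u` around the plaquette, which is closed, or nothing. -/
lemma classGrad_closed (i₀ : Fin d) (u : (Fin d → ℤ) → ℤ) (c : Quotient (linkedSetoid i₀ u))
    (x : Fin d → ℤ) (j : Fin d) :
    classGrad i₀ u c x i₀ + classGrad i₀ u c (x + Pi.single i₀ 1) j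
      = classGrad i₀ u c x j + classGrad i₀ u c (x + Pi.single j 1 : Fin d → ℤ) i₀ := by
  have hu : grad u i₀ x + grad u j (x + Pi.single i₀ 1)
      = grad u j x + grad u i₀ (x + Pi.single j 1) := by
    simp only [grad]
    rw [add_right_comm x (Pi.single j 1)]
    ring
  by_cases hex : ∃ p ∈ plaquette i₀ x j,
      Quotient.mk (linkedSetoid i₀ u) p = c ∧ grad u p.2 p.1 ≠ 0
  · obtain ⟨p, hp, hpc, hp0⟩ := hex
    have key : ∀ q ∈ plaquette i₀ x j, classGrad i₀ u c q.1 q.2 = grad u q.2 q.1 := by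
      intro q hq
      by_cases hq0 : grad u q.2 q.1 = 0
      · simp [classGrad, hq0]
      · have : Quotient.mk (linkedSetoid i₀ u) q = c := by
          rw [← hpc]
          exact Quotient.sound (s := linkedSetoid i₀ u)
            (Relation.ReflTransGen.single ⟨hq0, hp0, x, j, hq, hp⟩)
        simp [classGrad, this]
    have h1 := key (x, i₀) (by simp [plaquette])
    have h2 := key (x + Pi.single i₀ 1, j) (by simp [plaquette])
    have h3 := key (x, j) (by simp [plaquette])
    have h4 := key (x + Pi.single j 1, i₀) (by simp [plaquette])
    simp only at h1 h2 h3 h4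
    rw [h1, h2, h3, h4, hu]
  · have key : ∀ q ∈ plaquette i₀ x j, classGrad i₀ u c q.1 q.2 = 0 := by
      intro q hq
      by_contra h
      simp only [classGrad, ite_eq_right_iff, Classical.not_imp] at h
      exact hex ⟨q, hq, h⟩
    have h1 := key (x, i₀) (by simp [plaquette])
    have h2 := key (x + Pi.single i₀ 1, j) (by simp [plaquette])
    have h3 := key (x, j) (by simp [plaquette])
    have h4 := key (x + Pi.single j 1, i₀) (by simp [plaquette])
    simp only at h1 h2 h3 h4
    rw [h1, h2, h3, h4]

/-- `f` is a contour of size `n` around `v` in `Λ`: its gradient takes the values `-1, 0, 1`, and is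
supported on `n` edges that lie along a walk from `v` of length at most `4 * n`. -/
def IsContour (Λ : Finset (Fin d → ℤ)) (v : Fin d → ℤ) (n : ℕ) (f : (Fin d → ℤ) → ℤ) : Prop :=
  (∀ x ∉ Λ, f x = 0) ∧ (∀ x i, |grad f i x| ≤ 1) ∧
    ∃ K : Finset ((Fin d → ℤ) × Fin d), K.card = n ∧ (∀ x i, (x, i) ∈ K ↔ grad f i x ≠ 0) ∧
      ∃ w : ℕ → Fin d → ℤ, w 0 = v ∧ (∀ t k, |w (t + 1) k - w t k| ≤ 1) ∧
        ∀ p ∈ K, ∃ t ≤ 4 * n, p.1 = w t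

/-- On every edge on which `f` is not constant, `φ` has a gradient of the same sign. -/
def Follows (φ f : (Fin d → ℤ) → ℤ) : Prop :=
  ∀ x i, grad f i x ≠ 0 → 1 ≤ grad f i x * grad φ i x

lemma mem_box {L : ℕ} {x : Fin d → ℤ} : x ∈ box d L ↔ ∀ i, -(L : ℤ) ≤ x i ∧ x i ≤ L := by
  simp [box, Fintype.mem_piFinset]

lemma eq_of_forall_grad_eq_zero {f : (Fin d → ℤ) → ℤ} {i : Fin d} {x : Fin d → ℤ}
    (n : ℕ) (h : ∀ k < n, grad f i (x + Pi.single i (k : ℤ)) = 0) :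
    f x = f (x + Pi.single i (n : ℤ)) := by
  have := sum_grad f i x n
  rw [Finset.sum_eq_zero fun k hk => h k (Finset.mem_range.mp hk)] at this
  linarith

/-- A function that is constant along all edges outside of the box and vanishes far out in one
direction vanishes outside of the box. -/
lemma eq_zero_of_notMem_box {L : ℕ} {f : (Fin d → ℤ) → ℤ} {i₀ i₁ : Fin d} (h01 : i₁ ≠ i₀)
    (hconst : ∀ x i, x ∉ box d L → x + Pi.single i 1 ∉ box d L → grad f i x = 0)
    (hfar : ∀ x, (L : ℤ) + 1 ≤ x i₀ → f x = 0) {x : Fin d → ℤ} (hx : x ∉ box d L) : f x = 0 := by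
  have hline : ∀ (i : Fin d) (y : Fin d → ℤ),
      (∀ k : ℕ, y + Pi.single i (k : ℤ) ∉ box d L) → ∀ n : ℕ, f y = f (y + Pi.single i (n : ℤ)) := by
    intro i y hy n
    refine eq_of_forall_grad_eq_zero n fun k _ => hconst _ _ (hy k) ?_
    rw [add_assoc, ← Pi.single_add]
    exact_mod_cast hy (k + 1)
  -- With a coordinate other than `i₀` out of range, the ray in direction `i₀` escapes without
  -- meeting the box.
  have hA : ∀ y : Fin d → ℤ, (∃ j, j ≠ i₀ ∧ ¬ (-(L : ℤ) ≤ y j ∧ y j ≤ L)) → f y = 0 := by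
    rintro y ⟨j, hj, hyj⟩
    rw [hline i₀ y (fun k hk => hyj (by simpa [hj] using mem_box.mp hk j))
      ((L : ℤ) + 1 - y i₀).toNat]
    refine hfar _ ?_
    simp only [Pi.add_apply, Pi.single_eq_same]
    omega
  by_cases hj : ∃ j, j ≠ i₀ ∧ ¬ (-(L : ℤ) ≤ x j ∧ x j ≤ L)
  · exact hA x hj
  · have h0 : ¬ (-(L : ℤ) ≤ x i₀ ∧ x i₀ ≤ L) := by
      intro h0
      refine hx (mem_box.mpr fun j => ?_)
      by_cases hji : j = i₀
      · rw [hji]; exact h0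
      · by_contra hcon
        exact hj ⟨j, hji, hcon⟩
    by_cases hL : (L : ℤ) + 1 ≤ x i₀
    · exact hfar x hL
    -- Below the box the ray in direction `i₀` may hit it, so first move sideways along `i₁`.
    · rw [hline i₁ x (fun k hk => h0 (by simpa [h01.symm] using mem_box.mp hk i₀))
        ((L : ℤ) + 1 - x i₁).toNat]
      refine hA _ ⟨i₁, h01, ?_⟩
      simp only [Pi.add_apply, Pi.single_eq_same]
      omega

/-- The class gradients are gradients, and one of their potentials does not vanish at `v`. -/
lemma exists_class_potential {L : ℕ} {u : (Fin d → ℤ) → ℤ} (hu : ∀ x ∉ box d L, u x = 0)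
    {v : Fin d → ℤ} (hv : u v ≠ 0) (i₀ : Fin d) :
    ∃ (c : Quotient (linkedSetoid i₀ u)) (f : (Fin d → ℤ) → ℤ),
      (∀ x i, grad f i x = classGrad i₀ u c x i) ∧ (∀ x, (L : ℤ) + 1 ≤ x i₀ → f x = 0) ∧
        f v ≠ 0 := by
  classical
  have hout : ∀ x : Fin d → ℤ, (L : ℤ) + 1 ≤ x i₀ → x ∉ box d L := fun x hx hmem => by
    have := (mem_box.mp hmem i₀).2
    omega
  have hzero : ∀ c x i, (L : ℤ) + 1 ≤ x i₀ → classGrad i₀ u c x i = 0 := by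
    intro c x i hx
    have h2 : x + Pi.single i 1 ∉ box d L := by
      refine hout _ ?_
      by_cases h : i₀ = i
      · subst h; simp; omega
      · simpa [h] using hx
    rw [classGrad, grad, hu _ h2, hu _ (hout x hx)]
    simp
  choose f hf hfar using fun c => exists_grad_eq i₀ (hzero c) (classGrad_closed i₀ u c)
  by_contra hcon
  have hall : ∀ c, f c v = 0 := fun c => by
    by_contra h
    exact hcon ⟨c, f c, hf c, hfar c, h⟩
  set n := ((L : ℤ) + 1 - v i₀).toNat with hn
  have hfarv : (L : ℤ) + 1 ≤ (v + Pi.single i₀ (n : ℤ) : Fin d → ℤ) i₀ := by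
    simp only [Pi.add_apply, Pi.single_eq_same]
    omega
  have h1 := sum_grad u i₀ v n
  rw [hu _ (hout _ hfarv)] at h1
  have h2 : ∀ c, ∑ k ∈ Finset.range n, classGrad i₀ u c (v + Pi.single i₀ (k : ℤ)) i₀ = 0 := by
    intro c
    have := sum_grad (f c) i₀ v n
    rw [hall c, hfar c _ hfarv] at this
    simp_rw [hf] at this
    simpa using this
  -- Along the ray from `v` the gradient of `u` sums to `-u v`. Grouped by classes, each class
  -- contributes minus its potential at `v`, which was assumed to vanish.
  let g : ℕ → Quotient (linkedSetoid i₀ u) := fun k => Quotient.mk _ (v + Pi.single i₀ (k : ℤ), i₀)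
  rw [← Finset.sum_fiberwise_of_maps_to (t := (Finset.range n).image g) (g := g)
    fun k hk => Finset.mem_image_of_mem g hk] at h1
  rw [Finset.sum_eq_zero fun c _ => ?_] at h1
  · exact hv (by linarith)
  · rw [← h2 c, Finset.sum_filter]
    rfl

lemma finite_gradSupport {Λ : Finset (Fin d → ℤ)} {f : (Fin d → ℤ) → ℤ} (hf : ∀ x ∉ Λ, f x = 0) :
    {p : (Fin d → ℤ) × Fin d | grad f p.2 p.1 ≠ 0}.Finite := by
  have h1 := (Λ ×ˢ (Finset.univ : Finset (Fin d))).finite_toSet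
  refine (h1.union (h1.image fun p => (p.1 - Pi.single p.2 1, p.2))).subset ?_
  rintro ⟨x, i⟩ hx
  by_cases hxΛ : x ∈ Λ
  · exact Or.inl (by simpa using hxΛ)
  · right
    have : x + Pi.single i 1 ∈ Λ := by
      by_contra h
      exact hx (by simp [grad, hf _ h, hf _ hxΛ])
    exact ⟨(x + Pi.single i 1, i), by simpa using this, by simp⟩

/-- The function `f` is the potential of one class of jumps of the indicator of `φ ≥ 1`. Besides the
class being connected, the walk must reach it from `v` in time proportional to its size. -/
theorem exists_contour (hd : 2 ≤ d) {L : ℕ} {φ : (Fin d → ℤ) → ℤ} (hφ : ∀ x ∉ box d L, φ x = 0)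
    {v : Fin d → ℤ} (hv : 1 ≤ φ v) :
    ∃ n f, 1 ≤ n ∧ IsContour (box d L) v n f ∧ Follows φ f := by
  classical
  set i₀ : Fin d := ⟨0, by omega⟩
  set i₁ : Fin d := ⟨1, by omega⟩
  have h01 : i₁ ≠ i₀ := by simp [i₀, i₁]
  set u : (Fin d → ℤ) → ℤ := fun x => if 1 ≤ φ x then 1 else 0 with hu
  have hu0 : ∀ x ∉ box d L, u x = 0 := fun x hx => by simp [hu, hφ x hx]
  obtain ⟨c, f, hgrad, hfar, hfv⟩ := exists_class_potential hu0 (v := v) (by simp [hu, hv]) i₀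
  have hcl : ∀ x i, grad f i x ≠ 0 →
      Quotient.mk (linkedSetoid i₀ u) (x, i) = c ∧ grad f i x = grad u i x := by
    intro x i h
    rw [hgrad, classGrad] at h ⊢
    split_ifs at h ⊢ with hc
    · exact ⟨hc, rfl⟩
    · exact absurd rfl h
  have hfΛ : ∀ x ∉ box d L, f x = 0 := by
    intro x hx
    refine eq_zero_of_notMem_box h01 (fun y i hy hy' => ?_) hfar hx
    by_contra h
    have := (hcl y i h).2
    rw [this, grad, hu0 _ hy, hu0 _ hy'] at h
    exact h (by simp)
  set K := (finite_gradSupport hfΛ).toFinset with hK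
  have hmemK : ∀ x i, (x, i) ∈ K ↔ grad f i x ≠ 0 := fun x i => by simp [hK]
  have hex : ∃ k : ℕ, grad f i₀ (v + Pi.single i₀ (k : ℤ)) ≠ 0 := by
    by_contra! hcon
    refine hfv ?_
    rw [eq_of_forall_grad_eq_zero (f := f) (i := i₀) (x := v) ((L : ℤ) + 1 - v i₀).toNat
      fun k _ => hcon k]
    refine hfar _ ?_
    simp only [Pi.add_apply, Pi.single_eq_same]
    omega
  -- Distance from `v` to the first contour edge on the ray in direction `i₀`; up to there `f` keeps
  -- its nonzero value at `v`.
  set l := Nat.find hex with hl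
  have hray : ∀ k ≤ l, f (v + Pi.single i₀ (k : ℤ)) ≠ 0 := by
    intro k hk
    rw [← eq_of_forall_grad_eq_zero (f := f) (i := i₀) (x := v) k fun j hj => by
      have := Nat.find_min hex (m := j) (by omega)
      push Not at this
      exact this]
    exact hfv
  have hside : ∀ k ≤ l, ∃ j : ℕ,
      grad f i₁ (v + Pi.single i₀ (k : ℤ) + Pi.single i₁ (j : ℤ)) ≠ 0 := by
    intro k hk
    by_contra! hcon
    refine hray k hk ?_
    set y := v + Pi.single i₀ (k : ℤ)
    rw [eq_of_forall_grad_eq_zero ((L : ℤ) + 1 - y i₁).toNat fun j _ => hcon j]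
    refine hfΛ _ fun hmem => ?_
    have := (mem_box.mp hmem i₁).2
    simp only [Pi.add_apply, Pi.single_eq_same] at this
    omega
  choose! j hj using hside
  -- From each of the `l + 1` ray sites `f` must drop to zero in direction `i₁`, which gives a
  -- contour edge; these differ in the coordinate `i₀`. So the ray segment is no longer than the
  -- contour.
  have hlK : l + 1 ≤ K.card := by
    rw [← Finset.card_range (l + 1)]
    refine Finset.card_le_card_of_injOn
      (fun k => (v + Pi.single i₀ (k : ℤ) + Pi.single i₁ (j k : ℤ), i₁)) (fun k hk => ?_) ?_
    · rw [Finset.coe_range, Set.mem_Iio] at hk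
      exact (hmemK _ _).mpr (hj k (by omega))
    · intro a _ b _ hab
      have := congrFun (congrArg Prod.fst hab) i₀
      simpa [h01.symm] using this
  -- Contour and ray segment together are connected and have at most `2 * K.card` points. Covering
  -- them doubles this, whence the `4 * n` in `IsContour`.
  set S := K.image Prod.fst ∪ (Finset.range (l + 1)).image fun k : ℕ => v + Pi.single i₀ (k : ℤ)
    with hS
  have hScard : S.card ≤ 2 * K.card := by
    have h1 := Finset.card_union_le (K.image Prod.fst)
      ((Finset.range (l + 1)).image fun k : ℕ => v + Pi.single i₀ (k : ℤ))
    have h2 := Finset.card_image_le (s := K) (f := Prod.fst)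
    have h3 := Finset.card_image_le (s := Finset.range (l + 1))
      (f := fun k : ℕ => v + Pi.single i₀ (k : ℤ))
    rw [Finset.card_range] at h3
    rw [hS]
    omega
  have hrayS : ∀ k ≤ l, v + Pi.single i₀ (k : ℤ) ∈ S := fun k hk =>
    Finset.mem_union_right _ (Finset.mem_image.mpr ⟨k, Finset.mem_range.mpr (by omega), rfl⟩)
  have hreach_ray : ∀ k ≤ l, Relation.ReflTransGen
      (fun a b => b ∈ S ∧ ∀ k, |b k - a k| ≤ 1) v (v + Pi.single i₀ (k : ℤ)) := by
    intro k
    induction k with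
    | zero => intro _; simpa using Relation.ReflTransGen.refl
    | succ k ih =>
      intro hk
      refine (ih (by omega)).tail ⟨hrayS _ hk, fun m => ?_⟩
      by_cases hm : m = i₀
      · subst hm; simp
      · simp [hm]
  have hp0 := Nat.find_spec hex
  rw [← hl] at hp0
  have hreach : ∀ q : (Fin d → ℤ) × Fin d, Relation.ReflTransGen (Linked i₀ u)
      (v + Pi.single i₀ (l : ℤ), i₀) q → q ∈ K ∧ Relation.ReflTransGen
        (fun a b => b ∈ S ∧ ∀ k, |b k - a k| ≤ 1) v q.1 := by
    intro q hq
    induction hq with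
    | refl => exact ⟨(hmemK _ _).mpr hp0, hreach_ray l le_rfl⟩
    | @tail a b hpa hab ih =>
      have hbc : Quotient.mk (linkedSetoid i₀ u) b = c := by
        rw [← (hcl _ _ hp0).1]
        exact (Quotient.sound (s := linkedSetoid i₀ u) (hpa.tail hab)).symm
      have hbK : b ∈ K := by
        refine (hmemK b.1 b.2).mpr ?_
        rw [hgrad, classGrad, if_pos hbc]
        exact hab.2.1
      obtain ⟨x, i, ha', hb'⟩ := hab.2.2
      exact ⟨hbK, ih.2.tail ⟨Finset.mem_union_left _ (Finset.mem_image_of_mem _ hbK),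
        near_of_mem_plaquette ha' hb'⟩⟩
  obtain ⟨w, hw0, hw, hcov⟩ := exists_covering_walk (v := v) (S := S)
    (by simpa using hrayS 0 (Nat.zero_le _)) (by
      intro s hs
      rcases Finset.mem_union.mp hs with h | h
      · obtain ⟨p, hp, rfl⟩ := Finset.mem_image.mp h
        refine (hreach p ?_).2
        refine Quotient.exact (s := linkedSetoid i₀ u) ?_
        rw [(hcl _ _ hp0).1, (hcl p.1 p.2 ((hmemK _ _).mp hp)).1]
      · obtain ⟨k, hk, rfl⟩ := Finset.mem_image.mp h
        exact hreach_ray k (by have := Finset.mem_range.mp hk; omega))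
  have hu01 : ∀ x, (u x = 1 ∧ 1 ≤ φ x) ∨ (u x = 0 ∧ φ x ≤ 0) := by
    intro x
    simp only [hu]
    split_ifs with h
    · exact Or.inl ⟨rfl, h⟩
    · exact Or.inr ⟨rfl, by omega⟩
  refine ⟨K.card, f, by omega, ⟨hfΛ, fun x i => ?_, K, rfl, hmemK, w, hw0, hw, fun p hp => ?_⟩, ?_⟩
  · by_cases h : grad f i x = 0
    · simp [h]
    · rw [(hcl x i h).2, grad, abs_le]
      rcases hu01 x with h1 | h1 <;> rcases hu01 (x + Pi.single i 1) with h2 | h2 <;> omega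
  · obtain ⟨t, ht, hpt⟩ := hcov p.1 (Finset.mem_union_left _ (Finset.mem_image_of_mem _ hp))
    exact ⟨t, by omega, hpt⟩
  · intro x i h
    have h' := (hcl x i h).2
    rw [h'] at h ⊢
    rw [grad] at h ⊢
    rw [grad]
    rcases hu01 x with h1 | h1 <;> rcases hu01 (x + Pi.single i 1) with h2 | h2 <;>
      rw [h1.1, h2.1] at h ⊢ <;> omega

end Contours

end IVGFF

namespace IVGFF

/-! ### Energy gain, contour counting and the Peierls estimate -/

section Thermal

variable {d : ℕ}

lemma grad_neg (f : (Fin d → ℤ) → ℤ) (i : Fin d) (x : Fin d → ℤ) :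
    grad (-f) i x = -grad f i x := by
  simp only [grad, Pi.neg_apply]
  ring

lemma IsContour.neg {Λ : Finset (Fin d → ℤ)} {v : Fin d → ℤ} {n : ℕ} {f : (Fin d → ℤ) → ℤ}
    (h : IsContour Λ v n f) : IsContour Λ v n (-f) := by
  obtain ⟨h0, h1, K, hc, hK, hw⟩ := h
  refine ⟨fun x hx => by simp [h0 x hx], fun x i => by rw [grad_neg, abs_neg]; exact h1 x i,
    K, hc, fun x i => ?_, hw⟩
  rw [hK, grad_neg, neg_ne_zero]

lemma Follows.neg {φ f : (Fin d → ℤ) → ℤ} (h : Follows (-φ) f) : Follows φ (-f) := by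
  intro x i hx
  rw [grad_neg, neg_ne_zero] at hx
  have := h x i hx
  rw [grad_neg] at this ⊢
  linarith

theorem exists_contour_of_ne_zero (hd : 2 ≤ d) {L : ℕ} {φ : (Fin d → ℤ) → ℤ}
    (hφ : ∀ x ∉ box d L, φ x = 0) {v : Fin d → ℤ} (hv : φ v ≠ 0) :
    ∃ n f, IsContour (box d L) v (n + 1) f ∧ Follows φ f := by
  rcases lt_or_gt_of_ne hv with h | h
  · obtain ⟨n, f, hn, hf, hfol⟩ := exists_contour hd (φ := -φ) (fun x hx => by simp [hφ x hx])
      (v := v) (by simp only [Pi.neg_apply]; omega)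
    obtain ⟨m, rfl⟩ := Nat.exists_eq_add_of_le' hn
    exact ⟨m, -f, hf.neg, hfol.neg⟩
  · obtain ⟨n, f, hn, hf, hfol⟩ := exists_contour hd hφ (v := v) h
    obtain ⟨m, rfl⟩ := Nat.exists_eq_add_of_le' hn
    exact ⟨m, f, hf, hfol⟩

/-- The extension of a surface by zero to the whole lattice. -/
noncomputable def extend {Λ : Finset (Fin d → ℤ)} (φ : Surface Λ) (x : Fin d → ℤ) : ℤ :=
  if h : x ∈ Λ then φ.1 (toPlus ⟨x, h⟩) else 0

lemma extend_of_notMem {Λ : Finset (Fin d → ℤ)} (φ : Surface Λ) {x : Fin d → ℤ} (hx : x ∉ Λ) :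
    extend φ x = 0 := dif_neg hx

lemma extend_coe {Λ : Finset (Fin d → ℤ)} (φ : Surface Λ) (x : plus Λ) :
    extend φ x.1 = φ.1 x := by
  by_cases h : x.1 ∈ Λ
  · rw [extend, dif_pos h]
    rfl
  · rw [extend_of_notMem φ h, φ.2 x (x.2.resolve_left h)]

/-- The surface `φ - f`. -/
def shift {Λ : Finset (Fin d → ℤ)} (f : (Fin d → ℤ) → ℤ) (hf : ∀ x ∉ Λ, f x = 0)
    (φ : Surface Λ) : Surface Λ :=
  ⟨fun x => φ.1 x - f x.1, fun x hx => by simp only [φ.2 x hx, hf x.1 hx.1, sub_zero]⟩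

lemma shift_injective {Λ : Finset (Fin d → ℤ)} (f : (Fin d → ℤ) → ℤ) (hf : ∀ x ∉ Λ, f x = 0) :
    Function.Injective (shift f hf) := by
  intro φ ψ h
  refine Subtype.ext (funext fun x => ?_)
  have := congrFun (congrArg Subtype.val h) x
  simpa [shift] using this

/-- The difference of squares is `2 a b - b ^ 2`, where `b = ±1` and `a b ≥ 1` in the nonzero case.
-/
lemma sq_sub_sq_sub_ge {a b : ℤ} (hb : |b| ≤ 1) (hab : b ≠ 0 → 1 ≤ b * a) :
    (if b = 0 then 0 else 1 : ℝ) ≤ (a : ℝ) ^ 2 - ((a : ℝ) - b) ^ 2 := by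
  by_cases h : b = 0
  · simp [h]
  · have h1 := hab h
    have h2 : b ^ 2 ≤ 1 := (sq_le_one_iff_abs_le_one b).mpr hb
    have h3 : (1 : ℤ) ≤ a ^ 2 - (a - b) ^ 2 := by nlinarith
    rw [if_neg h]
    exact_mod_cast h3

lemma gradSq_shift {Λ : Finset (Fin d → ℤ)} {f : (Fin d → ℤ) → ℤ} (hf : ∀ x ∉ Λ, f x = 0)
    (φ : Surface Λ) (h1 : ∀ x i, |grad f i x| ≤ 1) (hfol : Follows (extend φ) f)
    {x y : plus Λ} {i : Fin d} (hxy : y.1 = x.1 + Pi.single i 1) :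
    (if grad f i x.1 = 0 then 0 else 1 : ℝ)
      ≤ gradSq φ.1 s(x, y) - gradSq (shift f hf φ).1 s(x, y) := by
  have h := sq_sub_sq_sub_ge (h1 x.1 i) (hfol x.1 i)
  refine h.trans (le_of_eq ?_)
  simp only [gradSq, Sym2.lift_mk, shift, grad, ← hxy, extend_coe]
  push_cast
  ring

lemma eq_add_single_of_adj {x y : Fin d → ℤ} (h : (lattice d).Adj x y) :
    ∃ i, y = x + Pi.single i 1 ∨ x = y + Pi.single i 1 := by
  obtain ⟨i, hi, hj⟩ := h
  refine ⟨i, ?_⟩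
  rcases (abs_eq zero_le_one).mp hi with h | h
  · right
    funext k
    by_cases hk : k = i
    · subst hk; simp; omega
    · simp [hk, hj k hk]
  · left
    funext k
    by_cases hk : k = i
    · subst hk; simp; omega
    · simp [hk, hj k hk]

lemma adj_add_single (x : Fin d → ℤ) (i : Fin d) : (lattice d).Adj x (x + Pi.single i 1) :=
  ⟨i, by simp, fun j hj => by simp [hj]⟩

lemma mem_plus_of_mem {Λ : Finset (Fin d → ℤ)} {x y : Fin d → ℤ} (hx : x ∈ Λ)
    (h : (lattice d).Adj x y) : y ∈ plus Λ := by
  by_cases hy : y ∈ Λ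
  · exact Or.inl hy
  · exact Or.inr ⟨hy, x, hx, h⟩

lemma mem_plus_of_grad_ne_zero {Λ : Finset (Fin d → ℤ)} {f : (Fin d → ℤ) → ℤ}
    (hf : ∀ x ∉ Λ, f x = 0) {x : Fin d → ℤ} {i : Fin d} (h : grad f i x ≠ 0) :
    x ∈ plus Λ ∧ x + Pi.single i 1 ∈ plus Λ := by
  by_cases hx : x ∈ Λ
  · exact ⟨Or.inl hx, mem_plus_of_mem hx (adj_add_single x i)⟩
  · have hy : x + Pi.single i 1 ∈ Λ := by
      by_contra hy
      exact h (by simp [grad, hf _ hx, hf _ hy])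
    exact ⟨mem_plus_of_mem hy (adj_add_single x i).symm, Or.inl hy⟩

/-- No edge loses, and each contour edge gains at least one. Contour edges lie in `Λ⁺` because `f`
vanishes off `Λ`, and distinct oriented edges remain distinct when unoriented because all point in
positive directions. -/
lemma card_le_sum_gradSq_sub {Λ : Finset (Fin d → ℤ)} {f : (Fin d → ℤ) → ℤ}
    (hf : ∀ x ∉ Λ, f x = 0) (φ : Surface Λ) (h1 : ∀ x i, |grad f i x| ≤ 1)
    (hfol : Follows (extend φ) f) {K : Finset ((Fin d → ℤ) × Fin d)}
    (hK : ∀ x i, (x, i) ∈ K ↔ grad f i x ≠ 0) :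
    (K.card : ℝ) ≤ ∑ e ∈ edges Λ, gradSq φ.1 e - ∑ e ∈ edges Λ, gradSq (shift f hf φ).1 e := by
  classical
  rw [← Finset.sum_sub_distrib]
  set D : Sym2 (plus Λ) → ℝ := fun e => gradSq φ.1 e - gradSq (shift f hf φ).1 e with hD
  have hD0 : ∀ e ∈ edges Λ, 0 ≤ D e := by
    intro e
    induction e with
    | _ x y =>
      intro he
      simp only [edges, Set.Finite.mem_toFinset, SimpleGraph.mem_edgeSet] at he
      obtain ⟨i, h | h⟩ := eq_add_single_of_adj (SimpleGraph.comap_adj.mp he)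
      · refine le_trans ?_ (gradSq_shift hf φ h1 hfol h)
        split_ifs <;> norm_num
      · rw [Sym2.eq_swap]
        refine le_trans ?_ (gradSq_shift hf φ h1 hfol h)
        split_ifs <;> norm_num
  have hmem : ∀ p : K, p.1.1 ∈ plus Λ ∧ p.1.1 + Pi.single p.1.2 1 ∈ plus Λ := fun p =>
    mem_plus_of_grad_ne_zero hf ((hK _ _).mp p.2)
  let g : K → Sym2 (plus Λ) := fun p => s(⟨p.1.1, (hmem p).1⟩, ⟨_, (hmem p).2⟩)
  have hg : Function.Injective g := by
    intro p q hpq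
    rcases Sym2.eq_iff.mp hpq with ⟨h2, h3⟩ | ⟨h2, h3⟩
    · have h2 := congrArg Subtype.val h2
      have h3 := congrArg Subtype.val h3
      simp only at h2 h3
      rw [h2, add_right_inj] at h3
      refine Subtype.ext (Prod.ext h2 ?_)
      by_contra hne
      have := congrFun h3 p.1.2
      simp [hne] at this
    · have h2 := congrArg Subtype.val h2
      have h3 := congrArg Subtype.val h3
      simp only at h2 h3
      rw [h2, add_assoc, add_eq_left] at h3
      have := congrFun h3 p.1.2
      simp only [Pi.add_apply, Pi.single_eq_same, Pi.zero_apply, Pi.single_apply] at this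
      split_ifs at this <;> omega
  calc (K.card : ℝ) = ∑ _p : K, (1 : ℝ) := by simp
    _ ≤ ∑ p : K, D (g p) := by
        refine Finset.sum_le_sum fun p _ => ?_
        have h := gradSq_shift hf φ h1 hfol (x := ⟨p.1.1, (hmem p).1⟩) (y := ⟨_, (hmem p).2⟩)
          (i := p.1.2) rfl
        rwa [if_neg ((hK _ _).mp p.2)] at h
    _ = ∑ e ∈ Finset.univ.image g, D e := (Finset.sum_image fun p _ q _ h => hg h).symm
    _ ≤ ∑ e ∈ edges Λ, D e := by
        refine Finset.sum_le_sum_of_subset_of_nonneg (fun e he => ?_) fun e he _ => hD0 e he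
        obtain ⟨p, -, rfl⟩ := Finset.mem_image.mp he
        simp only [g, edges, Set.Finite.mem_toFinset, SimpleGraph.mem_edgeSet]
        exact adj_add_single _ _

/-- Shifting a surface along a contour that it follows raises its weight. -/
lemma weight_le_mul_weight_shift {Λ : Finset (Fin d → ℤ)} {v : Fin d → ℤ} {n : ℕ}
    {f : (Fin d → ℤ) → ℤ} (hc : IsContour Λ v n f) (φ : Surface Λ) (hfol : Follows (extend φ) f)
    {β lam : ℝ} (hβ : 0 ≤ β) {η : Λ → ℝ} (hη : lam * |∑ x : Λ, η x * (f x.1 : ℝ)| ≤ n / 4)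
    (hlam : 0 ≤ lam) :
    weight Λ β lam η φ ≤ Real.exp (-(β / 4)) ^ n * weight Λ β lam η (shift f hc.1 φ) := by
  obtain ⟨hf, h1, K, hcard, hK, -⟩ := hc
  have h := card_le_sum_gradSq_sub hf φ h1 hfol hK
  rw [hcard] at h
  rw [weight, weight, ← Real.exp_nat_mul, ← Real.exp_add, Real.exp_le_exp, hamiltonian, hamiltonian]
  have hlin : ∑ x : Λ, η x * ((shift f hf φ).1 (toPlus x) : ℝ)
      = ∑ x : Λ, η x * (φ.1 (toPlus x) : ℝ) - ∑ x : Λ, η x * (f x.1 : ℝ) := by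
    rw [← Finset.sum_sub_distrib]
    refine Finset.sum_congr rfl fun x _ => ?_
    simp only [shift, toPlus]
    push_cast
    ring
  rw [hlin]
  have h2 := mul_le_mul_of_nonneg_left (le_abs_self (∑ x : Λ, η x * (f x.1 : ℝ))) hlam
  set A := ∑ e ∈ edges Λ, gradSq φ.1 e
  set B := ∑ e ∈ edges Λ, gradSq (shift f hf φ).1 e
  set F := ∑ x : Λ, η x * (f x.1 : ℝ)
  set G := ∑ x : Λ, η x * (φ.1 (toPlus x) : ℝ)
  have h3 : (n : ℝ) / 4 ≤ 1 / 2 * A - lam * G - (1 / 2 * B - lam * (G - F)) := by linarith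
  nlinarith [mul_le_mul_of_nonneg_left h3 hβ]

lemma eq_of_grad_eq {L : ℕ} (hd : 0 < d) {f g : (Fin d → ℤ) → ℤ} (hf : ∀ x ∉ box d L, f x = 0)
    (hg : ∀ x ∉ box d L, g x = 0) (h : ∀ x i, grad f i x = grad g i x) : f = g := by
  funext x
  set i : Fin d := ⟨0, hd⟩
  set n := ((L : ℤ) + 1 - x i).toNat with hn
  have hout : x + Pi.single i (n : ℤ) ∉ box d L := fun hmem => by
    have := (mem_box.mp hmem i).2
    simp only [Pi.add_apply, Pi.single_eq_same] at this
    omega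
  have h1 := sum_grad f i x n
  have h2 := sum_grad g i x n
  rw [Finset.sum_congr rfl fun k _ => h _ i, h2, hf _ hout, hg _ hout] at h1
  linarith

/-- The number of contours of size `n` grows at most exponentially. -/
lemma exists_contour_code (hd : 0 < d) (L : ℕ) (v : Fin d → ℤ) (n : ℕ) :
    ∃ code : {f // IsContour (box d L) v n f} →
      (Fin (4 * n + 1) → Fin d → Fin 3) × (Fin (4 * n + 1) → Fin d → Fin 3),
      Function.Injective code := by
  have hex : ∀ f : {f // IsContour (box d L) v n f},
      ∃ cl : (Fin (4 * n + 1) → Fin d → Fin 3) × (Fin (4 * n + 1) → Fin d → Fin 3),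
        (∀ x i, grad f.1 i x ≠ 0 → ∃ t : Fin (4 * n + 1), x = codedWalk v cl.1 t) ∧
        ∀ (t : Fin (4 * n + 1)) i, grad f.1 i (codedWalk v cl.1 t) = ((cl.2 t i : ℕ) : ℤ) - 1 := by
    rintro ⟨f, -, h1, K, -, hK, w, hw0, hw, hcov⟩
    -- A contour is coded by the steps of its walk and its gradients at the positions visited at
    -- times `0, …, 4 * n`. One index type of size `4 * n + 1` serves both, and the last step is not
    -- needed.
    obtain ⟨c, hc⟩ := exists_codedWalk_eq hw (4 * n + 1)
    rw [hw0] at hc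
    have hb : ∀ x i, 0 ≤ grad f i x + 1 ∧ grad f i x + 1 < 3 := fun x i => by
      have := abs_le.mp (h1 x i)
      omega
    refine ⟨⟨c, fun t i => ⟨(grad f i (codedWalk v c t) + 1).toNat, ?_⟩⟩, fun x i hx => ?_,
      fun t i => ?_⟩
    · have := hb (codedWalk v c t) i
      omega
    · obtain ⟨t, ht, hxt⟩ := hcov (x, i) ((hK x i).mpr hx)
      refine ⟨⟨t, by omega⟩, ?_⟩
      simp only at hxt
      rw [hxt, hc t (by omega)]
    · have := hb (codedWalk v c t) i
      simp only
      omega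
  choose code hcode1 hcode2 using hex
  refine ⟨code, fun f g hfg => Subtype.ext (eq_of_grad_eq hd f.2.1 g.2.1 fun x i => ?_)⟩
  have key : (∃ t : Fin (4 * n + 1), x = codedWalk v (code f).1 t) →
      grad f.1 i x = grad g.1 i x := by
    rintro ⟨t, rfl⟩
    rw [hcode2 f t i, hfg, hcode2 g t i]
  by_cases h1 : grad f.1 i x = 0
  · by_cases h2 : grad g.1 i x = 0
    · rw [h1, h2]
    · refine key ?_
      rw [hfg]
      exact hcode1 g x i h2
  · exact key (hcode1 f x i h1)

open scoped ENNReal in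
lemma tsum_contour_le (hd : 0 < d) (L : ℕ) (v : Fin d → ℤ) (n : ℕ) (a : ℝ≥0∞) :
    ∑' _f : {f // IsContour (box d L) v n f}, a ≤ (9 ^ d) ^ (4 * n + 1) * a := by
  obtain ⟨code, hcode⟩ := exists_contour_code hd L v n
  refine (ENNReal.tsum_comp_le_tsum_of_injective hcode fun _ => a).trans (le_of_eq ?_)
  rw [tsum_fintype, Finset.sum_const, Finset.card_univ, nsmul_eq_mul]
  congr 1
  simp only [Fintype.card_prod, Fintype.card_fun, Fintype.card_fin]
  push_cast
  rw [← mul_pow, ← mul_pow]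
  norm_num

lemma gibbs_apply {Λ : Finset (Fin d → ℤ)} (β lam : ℝ) (η : Λ → ℝ) (S : Set (Surface Λ)) :
    gibbs Λ β lam η S = (partitionFunction Λ β lam η)⁻¹ *
      ∑' φ : Surface Λ, S.indicator (fun φ => ENNReal.ofReal (weight Λ β lam η φ)) φ := by
  have hS : MeasurableSet S := (Set.to_countable S).measurableSet
  rw [gibbs, Measure.smul_apply, Measure.sum_apply _ hS, smul_eq_mul]
  congr 1
  refine tsum_congr fun φ => ?_
  rw [Measure.smul_apply, Measure.dirac_apply' _ hS, smul_eq_mul]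
  by_cases h : φ ∈ S <;> simp [h]

/-- The Peierls estimate: if no contour is favoured by the disorder, the surface is localized. -/
theorem gibbs_ne_zero_le (hd : 2 ≤ d) {L : ℕ} (v : box d L) {β lam : ℝ} (hβ : 0 < β)
    (hlam : 0 ≤ lam) {η : box d L → ℝ}
    (hη : ∀ n f, IsContour (box d L) v.1 n f →
      lam * |∑ x : box d L, η x * (f x.1 : ℝ)| ≤ n / 4) :
    gibbs (box d L) β lam η {φ | φ.1 (toPlus v) ≠ 0}
      ≤ ∑' n : ℕ, (9 ^ d) ^ (4 * (n + 1) + 1) * ENNReal.ofReal (Real.exp (-(β / 4)) ^ (n + 1)) := by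
  set Z := partitionFunction (box d L) β lam η with hZ
  set W : Surface (box d L) → ENNReal := fun φ => ENNReal.ofReal (weight (box d L) β lam η φ)
  set q : ℕ → ENNReal := fun n => ENNReal.ofReal (Real.exp (-(β / 4)) ^ (n + 1)) with hq
  have hpt : ∀ φ, {φ : Surface (box d L) | φ.1 (toPlus v) ≠ 0}.indicator W φ
      ≤ ∑' n, ∑' f : {f // IsContour (box d L) v.1 (n + 1) f}, q n * W (shift f.1 f.2.1 φ) := by
    intro φ
    by_cases hφ : φ.1 (toPlus v) ≠ 0
    · rw [Set.indicator_of_mem (by exact hφ)]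
      have hv : extend φ v.1 ≠ 0 := by rwa [extend, dif_pos v.2]
      obtain ⟨n, f, hf, hfol⟩ :=
        exists_contour_of_ne_zero hd (fun x hx => extend_of_notMem φ hx) hv
      refine le_trans ?_ (ENNReal.le_tsum n)
      refine le_trans ?_ (ENNReal.le_tsum ⟨f, hf⟩)
      simp only [W, hq]
      rw [← ENNReal.ofReal_mul (by positivity)]
      exact ENNReal.ofReal_le_ofReal
        (weight_le_mul_weight_shift hf φ hfol hβ.le (hη _ f hf) hlam)
    · rw [Set.indicator_of_notMem (by exact hφ)]
      exact zero_le
  have hsum : ∑' φ, {φ : Surface (box d L) | φ.1 (toPlus v) ≠ 0}.indicator W φ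
      ≤ Z * ∑' n : ℕ, (9 ^ d) ^ (4 * (n + 1) + 1) * q n := by
    calc _ ≤ ∑' φ, ∑' n, ∑' f : {f // IsContour (box d L) v.1 (n + 1) f},
          q n * W (shift f.1 f.2.1 φ) := ENNReal.tsum_le_tsum hpt
      _ = ∑' n, ∑' f : {f // IsContour (box d L) v.1 (n + 1) f},
          q n * ∑' φ, W (shift f.1 f.2.1 φ) := by
          rw [ENNReal.tsum_comm]
          refine tsum_congr fun n => ?_
          rw [ENNReal.tsum_comm]
          exact tsum_congr fun f => ENNReal.tsum_mul_left
      _ ≤ ∑' n, ∑' _f : {f // IsContour (box d L) v.1 (n + 1) f}, q n * Z := by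
          -- For a fixed contour the shifted surfaces are distinct, so their weights sum to at most
          -- `Z`.
          refine ENNReal.tsum_le_tsum fun n => ENNReal.tsum_le_tsum fun f => ?_
          exact mul_le_mul_right (ENNReal.tsum_comp_le_tsum_of_injective
            (shift_injective f.1 f.2.1) W) _
      _ ≤ ∑' n : ℕ, (9 ^ d) ^ (4 * (n + 1) + 1) * (q n * Z) :=
          ENNReal.tsum_le_tsum fun n => tsum_contour_le (by omega) L v.1 (n + 1) _
      _ = _ := by
          rw [← ENNReal.tsum_mul_left]
          exact tsum_congr fun n => by ring
  rw [gibbs_apply]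
  calc _ ≤ Z⁻¹ * (Z * ∑' n : ℕ, (9 ^ d) ^ (4 * (n + 1) + 1) * q n) := mul_le_mul_right hsum _
    _ = _ := by
        rw [← mul_assoc, ENNReal.inv_mul_cancel (partitionFunction_ne_zero _ β lam η)
          (partitionFunction_ne_top (by omega) _ hβ lam η), one_mul]

/-- The threshold on `β` makes the ratio `9 ^ (4 d) exp (-β / 4)` at most `1 / 2`, so the sum is at
most twice its first term. -/
lemma tsum_contour_weight_le {β : ℝ} (hβ : 4 * Real.log (2 * (9 ^ d) ^ 4) < β) :
    ∑' n : ℕ, (9 ^ d) ^ (4 * (n + 1) + 1) * ENNReal.ofReal (Real.exp (-(β / 4)) ^ (n + 1))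
      ≤ ENNReal.ofReal (2 * (9 ^ d) ^ 5 * Real.exp (-(β / 4))) := by
  set a := Real.exp (-(β / 4)) with ha
  have ha0 : 0 < a := Real.exp_pos _
  have hsmall : (9 ^ d) ^ 4 * a ≤ 1 / 2 := by
    have h1 : 2 * (9 ^ d) ^ 4 < Real.exp (β / 4) := by
      rw [← Real.log_lt_iff_lt_exp (by positivity)]
      linarith
    rw [ha, Real.exp_neg, ← div_eq_mul_inv, div_le_iff₀ (Real.exp_pos _)]
    linarith
  have hterm : ∀ n : ℕ, (9 ^ d : ENNReal) ^ (4 * (n + 1) + 1) * ENNReal.ofReal (a ^ (n + 1))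
      ≤ ENNReal.ofReal ((9 ^ d) ^ 5 * a) * 2⁻¹ ^ n := by
    intro n
    have h9 : (9 : ENNReal) = ENNReal.ofReal 9 := by simp
    have h2 : (2⁻¹ : ENNReal) = ENNReal.ofReal (1 / 2) := by
      rw [one_div, ENNReal.ofReal_inv_of_pos (by norm_num)]; simp
    rw [h9, h2, ← ENNReal.ofReal_pow (by positivity), ← ENNReal.ofReal_pow (by positivity),
      ← ENNReal.ofReal_pow (by positivity), ← ENNReal.ofReal_mul (by positivity),
      ← ENNReal.ofReal_mul (by positivity)]
    refine ENNReal.ofReal_le_ofReal ?_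
    calc ((9 : ℝ) ^ d) ^ (4 * (n + 1) + 1) * a ^ (n + 1)
        = (9 ^ d) ^ 5 * a * ((9 ^ d) ^ 4 * a) ^ n := by
          rw [mul_pow _ a, ← pow_mul (9 ^ d : ℝ)]; ring
      _ ≤ (9 ^ d) ^ 5 * a * (1 / 2) ^ n := by gcongr
  refine (ENNReal.tsum_le_tsum hterm).trans (le_of_eq ?_)
  rw [ENNReal.tsum_mul_left, ENNReal.tsum_geometric, ENNReal.one_sub_inv_two, inv_inv,
    mul_assoc (2 : ℝ), mul_comm (2 : ℝ), ENNReal.ofReal_mul (q := 2) (by positivity),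
    ENNReal.ofReal_ofNat]

lemma thermal_indicator {Λ : Finset (Fin d → ℤ)} (β lam : ℝ) (η : Λ → ℝ) (S : Set (Surface Λ)) :
    thermal Λ β lam η (S.indicator 1) = (gibbs Λ β lam η).real S :=
  integral_indicator_one (Set.to_countable S).measurableSet

end Thermal

end IVGFF

/-! ### Choice of constants and conclusion -/

theorem mainTheorem8 (d : ℕ) (hd : 3 ≤ d) :
    ∃ β₀ lam₀ C c : ℝ, 0 < β₀ ∧ 0 < lam₀ ∧ 0 < C ∧ 0 < c ∧
      ∀ (L : ℕ), 2 ≤ L →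
      ∀ {Ω : Type*} [MeasurableSpace Ω] (P : Measure Ω) [IsProbabilityMeasure P]
        (η : IVGFF.box d L → Ω → ℝ),
        (∀ x, HasLaw (η x) (gaussianReal 0 1) P) → iIndepFun η P →
      ∀ β lam : ℝ, β₀ < β → 0 < lam → lam < lam₀ →
      ∀ v : IVGFF.box d L,
        1 - Real.exp (-c / lam ^ 2) ≤
          P.real {ω | IVGFF.thermal (IVGFF.box d L) β lam (fun x => η x ω)
              (Set.indicator {φ | φ.1 (IVGFF.toPlus v) ≠ 0} 1)
            ≤ C * Real.exp (-β / 8)} := by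
  have hκ := IVGFF.chainConst_pos
  set κ := IVGFF.chainConst
  have hlog6 : 0 < Real.log (6 ^ (d + 1)) :=
    Real.log_pos (one_lt_pow₀ (by norm_num) (by omega))
  have hβ₀ : 0 < 4 * Real.log (2 * (9 ^ d) ^ 4) := by
    have h1 : (1 : ℝ) ≤ (9 ^ d) ^ 4 := one_le_pow₀ (one_le_pow₀ (by norm_num))
    have := Real.log_pos (show (1 : ℝ) < 2 * (9 ^ d) ^ 4 by linarith)
    linarith
  refine ⟨4 * Real.log (2 * (9 ^ d) ^ 4), 1 / (4 * κ * Real.sqrt (2 * Real.log (6 ^ (d + 1)))),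
    2 * (9 ^ d) ^ 5, 1 / (64 * κ ^ 2), hβ₀, by positivity, by positivity, by positivity, ?_⟩
  intro L _ Ω _ P _ η hlaw hind β lam hβ hlam hlam₀ v
  have hβ0 : 0 < β := hβ₀.trans hβ
  -- Chosen so that the chaining bound `λ κ T N` equals `N / 4`, half of the energy gain. The bound
  -- `lam₀` ensures that `T` is large enough for the regularity estimate.
  set T := 1 / (4 * κ * lam) with hT
  have hT0 : 0 < T := by positivity
  have hTsq : 2 * Real.log (6 ^ (d + 1)) ≤ T ^ 2 := by
    have h1 : Real.sqrt (2 * Real.log (6 ^ (d + 1))) ≤ T := by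
      rw [hT, le_div_iff₀ (by positivity)]
      rw [lt_div_iff₀ (by positivity)] at hlam₀
      linarith
    exact (Real.sqrt_le_left hT0.le).mp h1
  have hT6 : (6 : ℝ) ^ (d + 1) ≤ Real.exp (T ^ 2 / 2) := by
    rw [← Real.log_le_iff_le_exp (by positivity)]
    linarith
  have hbad : P.real {ω | ¬ IVGFF.IsRegular (IVGFF.box d L) v.1 T fun x => η x ω}
      ≤ Real.exp (-(1 / (64 * κ ^ 2)) / lam ^ 2) := by
    have h := IVGFF.prob_not_isRegular_le (by omega) (IVGFF.box d L) v.1 hT0.le hT6 hlaw hind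
    refine (ENNReal.toReal_mono ENNReal.ofReal_ne_top h).trans ?_
    rw [ENNReal.toReal_ofReal (by positivity)]
    have hexp : -(1 / (64 * κ ^ 2)) / lam ^ 2 = -(T ^ 2 / 4) := by
      rw [hT]; field_simp; ring
    -- Half of the exponent absorbs the factor `4`; the other half is `c / λ ^ 2` with `c = 1 / (64
    -- κ ^ 2)`.
    have hsplit : -(T ^ 2 / 2) = -(T ^ 2 / 4) + -(T ^ 2 / 4) := by ring
    have h4 : 4 * Real.exp (-(T ^ 2 / 4)) ≤ 1 := by
      have h36 : (6 : ℝ) ^ 2 ≤ Real.exp (T ^ 2 / 4) ^ 2 := by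
        rw [← Real.exp_nat_mul]
        calc (6 : ℝ) ^ 2 ≤ 6 ^ (d + 1) := pow_le_pow_right₀ (by norm_num) (by omega)
          _ ≤ Real.exp (T ^ 2 / 2) := hT6
          _ = _ := by congr 1; push_cast; ring
      have h6 := (pow_le_pow_iff_left₀ (by norm_num) (Real.exp_pos _).le two_ne_zero).mp h36
      rw [Real.exp_neg, ← div_eq_mul_inv, div_le_one (Real.exp_pos _)]
      linarith
    rw [hexp, hsplit, Real.exp_add, ← mul_assoc]
    exact mul_le_of_le_one_left (Real.exp_pos _).le h4
  have hgood : {ω | IVGFF.IsRegular (IVGFF.box d L) v.1 T fun x => η x ω} ⊆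
      {ω | IVGFF.thermal (IVGFF.box d L) β lam (fun x => η x ω)
        (Set.indicator {φ | φ.1 (IVGFF.toPlus v) ≠ 0} 1)
          ≤ 2 * (9 ^ d) ^ 5 * Real.exp (-β / 8)} := by
    intro ω hω
    rw [Set.mem_ofPred_eq, IVGFF.thermal_indicator]
    have h := (IVGFF.gibbs_ne_zero_le (by omega) v hβ0 hlam.le (η := fun x => η x ω)
      fun n f hf => ?_).trans (IVGFF.tsum_contour_weight_le hβ)
    · refine (ENNReal.toReal_mono ENNReal.ofReal_ne_top h).trans ?_
      rw [ENNReal.toReal_ofReal (by positivity)]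
      -- The estimate holds with `exp (-β / 4)`, which is stronger than required.
      gcongr
      linarith
    · obtain ⟨hf0, hf1, K, rfl, hK, w, hw0, hw, hcov⟩ := hf
      have hreg : IVGFF.IsRegular (IVGFF.box d L) (w 0) T fun x => η x ω := by
        rw [hw0]
        exact hω
      have hsum := IVGFF.abs_sum_mul_le_of_isRegular hd hT0.le hw hreg hf0
        (fun x i => (hK x i).mpr) hf1 hcov
      calc lam * |∑ x : IVGFF.box d L, η x ω * (f x.1 : ℝ)|
          ≤ lam * (κ * (T * K.card)) := mul_le_mul_of_nonneg_left hsum hlam.le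
        _ = K.card / 4 := by rw [hT]; field_simp
  -- Subadditivity suffices here, so the regular event need not be shown measurable.
  have hone : 1 ≤ P.real {ω | IVGFF.IsRegular (IVGFF.box d L) v.1 T fun x => η x ω}
      + P.real {ω | ¬ IVGFF.IsRegular (IVGFF.box d L) v.1 T fun x => η x ω} := by
    refine le_trans (le_of_eq ?_) (measureReal_union_le _ _)
    rw [show {ω | IVGFF.IsRegular (IVGFF.box d L) v.1 T fun x => η x ω} ∪
      {ω | ¬ IVGFF.IsRegular (IVGFF.box d L) v.1 T fun x => η x ω} = Set.univ from
        Set.union_compl_self _, probReal_univ]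
  have hmono := measureReal_mono (μ := P) hgood
  linarith
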